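/- **Conventions.** A *diffeological space* is a set $X$ with a family of maps $U\to X$ ($U$ open in some $\mathbb{R}^n$), called plots, which contains the constant maps, is closed under precomposition with smooth maps between open subsets of Euclidean spaces, and satisfies the sheaf condition. A map $f:X\to Y$ is *smooth* if $f\circ p$ is a plot of $Y$ for every plot $p$ of $X$. A subset $A \subseteq X$ carries the sub-diffeology, whose plots are the plots of $X$ with values in $A$. The set $C^\infty(X,Y)$ of smooth maps carries the functional diffeology: $p:U\to C^\infty(X,Y)$ is a plot if and only if $U\times X\to Y$, $(u,x)\mapsto p(u)(x)$, is smooth. *Smooth homotopy groups.* Write $x\simeq y$ in $X$ if there is a smooth path $\gamma:\mathbb{R}\to X$ with $\gamma(0)=x$ and $\gamma(1)=y$; this is an equivalence relation, and $\pi_0^D(X)=X/{\simeq}$. For $x\in X$ let $\Omega(X,x)=\{\gamma\in C^\infty(\mathbb{R},X):\gamma(0)=\gamma(1)=x\}$, with the sub-diffeology of the functional diffeology and with the constant loop at $x$ as base point. Put $\Omega^0(X,x)=(X,x)$, $\Omega^{n}(X,x)=\Omega(\Omega^{n-1}(X,x))$ for $n\ge 1$, and $$\pi_n^D(X,x)=\pi_0^D(\Omega^n(X,x)),$$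 pointed by the class of the base point. For $n\ge1$ it is a group: every loop is equivalent to a stationary loop (one that is constant on $(-\infty,\epsilon)$ and on $(1-\epsilon,\infty)$ for some $\epsilon>0$), and stationary loops are composed in the usual way. *Smooth singular simplicial set.* Let $\mathbb{A}^n=\{(x_0,\dots,x_n)\in\mathbb{R}^{n+1}:\sum_i x_i=1\}$ with the sub-diffeology of $\mathbb{R}^{n+1}$. A monotone map $\theta:[m]\to[n]$ induces the affine map $\mathbb{A}^m\to\mathbb{A}^n$ whose $j$-th coordinate is $\sum_{\theta(i)=j}x_i$. The simplicial set $S^D(X)$ has $S^D_n(X)=C^\infty(\mathbb{A}^n,X)$, with simplicial operators given by precomposition with these affine maps. A point $x\in X$ is regarded as a $0$-simplex of $S^D(X)$. *Simplicial homotopy groups.* For a Kan complex $S$ with a $0$-simplex $x$, $\pi_n^s(S,x)$ is the set of simplicial homotopy classes, relative to $\partial\Delta^n$, of maps of pairs $(\Delta^n,\partial\Delta^n)\to(S,x)$, pointed by the class of the constant map. For $n\ge1$ it is a group: $[f][g]=[d_nh]$ for any $(n+1)$-simplex $h$ of $S$ with $d_{n-1}h=f$, $d_{n+1}h=g$ and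 all other faces $d_ih$, $i<n-1$, constant at $x$. **Theorem.** Let $(X,x)$ be a pointed diffeological space such that $S^D(X)$ is a Kan complex. Then for every $n\ge0$ there is a bijection $$e_{X,x,n}:\ \pi_n^D(X,x)\;\xrightarrow{\ \cong\ }\;\pi_n^s(S^D(X),x)$$ that preserves base points and is an isomorphism of groups if $n\ge1$. These bijections can be chosen to be natural: if $(X,x)$ and $(Y,y)$ are pointed diffeological spaces such that $S^D(X)$ and $S^D(Y)$ are Kan complexes, and $f:X\to Y$ is a smooth map with $f(x)=y$, then $e_{Y,y,n}\circ\pi_n^D(f)=\pi_n^s(S^D(f))\circ e_{X,x,n}$ for every $n\ge0$. -/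

import Mathlib

universe u v w

namespace Diffeo

open Diffeology
open scoped ContDiff

/-! ### Diffeologies on subspaces, products and mapping spaces -/

section Constructions

variable {X : Type u} {Y : Type v} {Z : Type w}

/-- Reformulation of the sheaf condition: a map that is a plot after composition with every smooth
map into the members of an open cover is a plot. -/
theorem isPlot_of_local [DiffeologicalSpace X] {n : ℕ} {p : EuclideanSpace ℝ (Fin n) → X}
    (hp : ∀ z, ∃ u : Set (EuclideanSpace ℝ (Fin n)), IsOpen u ∧ z ∈ u ∧
      ∀ (m : ℕ) (f : EuclideanSpace ℝ (Fin m) → EuclideanSpace ℝ (Fin n)),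
        (∀ t, f t ∈ u) → ContDiff ℝ ∞ f → IsPlot (p ∘ f)) : IsPlot p :=
  DiffeologicalSpace.locality fun z => by
    obtain ⟨u, hu, hz, h⟩ := hp z
    exact ⟨u, hu, hz, fun {m f} hf hf' => h m f hf hf'⟩

/-- The sub-diffeology: a map into a subset is a plot if and only if it is a plot of the ambient
diffeological space. -/
instance subDiffeology [DiffeologicalSpace X] (P : X → Prop) :
    DiffeologicalSpace {x : X // P x} where
  plots _ := {p | IsPlot fun t => (p t : X)}
  constant_plots x := isPlot_const (x := (x : X))
  plot_reparam hp hf := isPlot_reparam hp hf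
  locality hp := isPlot_of_local fun z => by
    obtain ⟨u, hu, hz, h⟩ := hp z
    exact ⟨u, hu, hz, fun m f hf hf' => h hf hf'⟩

/-- The product diffeology: a map into `X × Y` is a plot if and only if both components are. -/
instance prodDiffeology [DiffeologicalSpace X] [DiffeologicalSpace Y] :
    DiffeologicalSpace (X × Y) where
  plots _ := {p | IsPlot (fun t => (p t).1) ∧ IsPlot (fun t => (p t).2)}
  constant_plots x := ⟨isPlot_const (x := x.1), isPlot_const (x := x.2)⟩
  plot_reparam hp hf := ⟨isPlot_reparam hp.1 hf, isPlot_reparam hp.2 hf⟩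
  locality hp :=
    ⟨isPlot_of_local fun z => by
      obtain ⟨u, hu, hz, h⟩ := hp z
      exact ⟨u, hu, hz, fun m f hf hf' => (h hf hf').1⟩,
    isPlot_of_local fun z => by
      obtain ⟨u, hu, hz, h⟩ := hp z
      exact ⟨u, hu, hz, fun m f hf hf' => (h hf hf').2⟩⟩

/-- The set `C^∞(X, Y)` of smooth maps. -/
abbrev SmoothMap (X : Type u) (Y : Type v) [DiffeologicalSpace X] [DiffeologicalSpace Y] :=
  {f : X → Y // DSmooth f}

section Basic

variable [DiffeologicalSpace X] [DiffeologicalSpace Y] [DiffeologicalSpace Z]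

theorem isPlot_sub_iff {P : X → Prop} {n : ℕ} {p : EuclideanSpace ℝ (Fin n) → {x : X // P x}} :
    IsPlot p ↔ IsPlot fun t => (p t : X) := Iff.rfl

theorem isPlot_prod_iff {n : ℕ} {p : EuclideanSpace ℝ (Fin n) → X × Y} :
    IsPlot p ↔ IsPlot (fun t => (p t).1) ∧ IsPlot (fun t => (p t).2) := Iff.rfl

theorem dSmooth_val {P : X → Prop} : DSmooth (Subtype.val : {x : X // P x} → X) :=
  fun _ _ hp => hp

theorem dSmooth_sub_iff {P : Y → Prop} {f : X → {y : Y // P y}} :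
    DSmooth f ↔ DSmooth fun t => (f t : Y) := Iff.rfl

theorem dSmooth_fst : DSmooth (Prod.fst : X × Y → X) := fun _ _ hp => hp.1

theorem dSmooth_snd : DSmooth (Prod.snd : X × Y → Y) := fun _ _ hp => hp.2

theorem dSmooth_prodMk {f : Z → X} {g : Z → Y} (hf : DSmooth f) (hg : DSmooth g) :
    DSmooth fun z => (f z, g z) := fun n p hp => ⟨hf n p hp, hg n p hp⟩

end Basic

/-- The functional diffeology on `C^∞(X, Y)`: a map `p : U → C^∞(X, Y)` is a plot if and only if
`U × X → Y`, `(u, x) ↦ p u x`, is smooth. -/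
instance mapDiffeology [DiffeologicalSpace X] [DiffeologicalSpace Y] :
    DiffeologicalSpace (SmoothMap X Y) where
  plots n := {p | DSmooth fun z : EuclideanSpace ℝ (Fin n) × X => (p z.1).1 z.2}
  constant_plots f := f.2.comp dSmooth_snd
  plot_reparam {n m p f} hp hf :=
    DSmooth.comp hp (dSmooth_prodMk (hf.dSmooth.comp dSmooth_fst) dSmooth_snd)
  locality {n p} hp := by
    intro k q hq
    refine isPlot_of_local fun z => ?_
    obtain ⟨u, hu, hz, h⟩ := hp (q z).1
    have hc : ContDiff ℝ ∞ fun t => (q t).1 := hq.1.contDiff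
    refine ⟨(fun t => (q t).1) ⁻¹' u, hu.preimage hc.continuous, hz, fun m f hf hf' => ?_⟩
    have h1 := h (f := fun t => (q (f t)).1) hf (hc.comp hf')
    exact h1 m (fun t => (t, (q (f t)).2)) ⟨isPlot_id, isPlot_reparam hq.2 hf'⟩

variable [DiffeologicalSpace X] [DiffeologicalSpace Y] [DiffeologicalSpace Z]

/-- Cartesian closedness. -/
theorem dSmooth_map_iff {f : Z → SmoothMap X Y} :
    DSmooth f ↔ DSmooth fun z : Z × X => (f z.1).1 z.2 := by
  constructor
  · intro h n p hp
    exact h n (fun t => (p t).1) hp.1 n (fun t => (t, (p t).2)) ⟨isPlot_id, hp.2⟩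
  · intro h n p hp
    exact h.comp (dSmooth_prodMk (hp.dSmooth.comp dSmooth_fst) dSmooth_snd)

end Constructions

/-! ### Smooth path components -/

/-- A cut-off function: smooth, with values in `[0, 1]`, equal to `0` on `(-∞, 1/3]` and to `1` on
`[2/3, ∞)`. -/
noncomputable def cut (t : ℝ) : ℝ := Real.smoothTransition (3 * t - 1)

theorem cut_contDiff : ContDiff ℝ ∞ cut :=
  Real.smoothTransition.contDiff.comp (by fun_prop)

theorem cut_dSmooth : DSmooth cut := cut_contDiff.dSmooth

theorem cut_of_le {t : ℝ} (h : t ≤ 1 / 3) : cut t = 0 :=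
  Real.smoothTransition.zero_of_nonpos (by linarith)

theorem cut_of_ge {t : ℝ} (h : 2 / 3 ≤ t) : cut t = 1 :=
  Real.smoothTransition.one_of_one_le (by linarith)

/-- Composition of the stationary paths `γ ∘ cut` and `δ ∘ cut` in the usual way. -/
noncomputable def concat {X : Type u} (γ δ : ℝ → X) (t : ℝ) : X :=
  if t ≤ 1 / 2 then γ (cut (2 * t)) else δ (cut (2 * t - 1))

theorem concat_zero {X : Type u} (γ δ : ℝ → X) : concat γ δ 0 = γ 0 := by
  simp only [concat]
  rw [if_pos (by norm_num), cut_of_le (by norm_num)]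

theorem concat_one {X : Type u} (γ δ : ℝ → X) : concat γ δ 1 = δ 1 := by
  simp only [concat]
  rw [if_neg (by norm_num), cut_of_ge (by norm_num)]

section PathComponents

variable {X : Type u} {Y : Type v} [DiffeologicalSpace X] [DiffeologicalSpace Y]

/-- Gluing of two smooth maps along the overlap `a < c < b`. -/
theorem dSmooth_glue {p q r : X → Y} {c : X → ℝ} {a b : ℝ} (hab : a < b) (hc : DSmooth c)
    (hq : DSmooth q) (hr : DSmooth r) (hpq : ∀ z, c z < b → p z = q z)
    (hpr : ∀ z, a < c z → p z = r z) : DSmooth p := by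
  intro n s hs
  have hcs : Continuous (c ∘ s) := (hs.dSmooth_comp hc).contDiff.continuous
  refine isPlot_of_local fun z => ?_
  rcases lt_or_ge a (c (s z)) with h | h
  · refine ⟨(c ∘ s) ⁻¹' Set.Ioi a, isOpen_Ioi.preimage hcs, h, fun m f hf hf' => ?_⟩
    have : (p ∘ s) ∘ f = r ∘ (s ∘ f) := funext fun t => hpr _ (hf t)
    rw [this]
    exact (isPlot_reparam hs hf').dSmooth_comp hr
  · refine ⟨(c ∘ s) ⁻¹' Set.Iio b, isOpen_Iio.preimage hcs, lt_of_le_of_lt h hab,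
      fun m f hf hf' => ?_⟩
    have : (p ∘ s) ∘ f = q ∘ (s ∘ f) := funext fun t => hpq _ (hf t)
    rw [this]
    exact (isPlot_reparam hs hf').dSmooth_comp hq

/-- Two points are related if a smooth path `ℝ → X` takes the value `x` at `0` and `y` at `1`. -/
def PathRel (x y : X) : Prop := ∃ γ : ℝ → X, DSmooth γ ∧ γ 0 = x ∧ γ 1 = y

/-- Concatenation is smooth, also for families of paths. -/
theorem concat_dSmooth_family {F G : Y → ℝ → X} {T : Y → ℝ} (hT : DSmooth T)
    (hF : DSmooth fun z : Y × ℝ => F z.1 z.2) (hG : DSmooth fun z : Y × ℝ => G z.1 z.2)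
    (h : ∀ y, F y 1 = G y 0) : DSmooth fun y => concat (F y) (G y) (T y) := by
  have hc2 : DSmooth fun t : ℝ => cut (2 * t) :=
    (cut_contDiff.comp (f := fun t : ℝ => 2 * t) (by fun_prop)).dSmooth
  have hc1 : DSmooth fun t : ℝ => cut (2 * t - 1) :=
    (cut_contDiff.comp (f := fun t : ℝ => 2 * t - 1) (by fun_prop)).dSmooth
  refine dSmooth_glue (a := 1 / 3) (b := 2 / 3) (by norm_num) hT
    (q := fun y => F y (cut (2 * T y))) (r := fun y => G y (cut (2 * T y - 1)))
    (hF.comp (dSmooth_prodMk dSmooth_id (hc2.comp hT)))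
    (hG.comp (dSmooth_prodMk dSmooth_id (hc1.comp hT))) ?_ ?_
  · intro z hz
    by_cases h' : T z ≤ 1 / 2
    · simp only [concat, h', if_true]
    · simp only [concat, h', if_false]
      rw [cut_of_le (by linarith), cut_of_ge (by linarith), h]
  · intro z hz
    by_cases h' : T z ≤ 1 / 2
    · simp only [concat, h', if_true]
      rw [cut_of_le (t := 2 * T z - 1) (by linarith), cut_of_ge (by linarith), h]
    · simp only [concat, h', if_false]

theorem concat_dSmooth {γ δ : ℝ → X} (hγ : DSmooth γ) (hδ : DSmooth δ) (h : γ 1 = δ 0) :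
    DSmooth (concat γ δ) :=
  concat_dSmooth_family (Y := ℝ) (F := fun _ => γ) (G := fun _ => δ) dSmooth_id
    (hγ.comp dSmooth_snd) (hδ.comp dSmooth_snd) fun _ => h

variable (X) in
/-- Smooth path components form an equivalence relation. -/
def pathSetoid : Setoid X where
  r := PathRel
  iseqv :=
    { refl := fun x => ⟨fun _ => x, dSmooth_const, rfl, rfl⟩
      symm := by
        rintro x y ⟨γ, h, h0, h1⟩
        exact ⟨fun t => γ (1 - t),
          h.comp (f := fun t : ℝ => 1 - t) (ContDiff.dSmooth (by fun_prop)),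
          by simp [h1], by simp [h0]⟩
      trans := by
        rintro x y z ⟨γ, h, h0, h1⟩ ⟨δ, h', h0', h1'⟩
        exact ⟨concat γ δ, concat_dSmooth h h' (h1.trans h0'.symm),
          by rw [concat_zero, h0], by rw [concat_one, h1']⟩ }

variable (X) in
/-- The set `π₀^D(X)` of smooth path components. -/
def Pi0 : Type u := Quotient (pathSetoid X)

/-- The smooth path component of a point. -/
def Pi0.mk (x : X) : Pi0 X := Quotient.mk (pathSetoid X) x

/-- The map induced by a smooth map on smooth path components. -/
def Pi0.map (f : X → Y) (hf : DSmooth f) : Pi0 X → Pi0 Y :=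
  Quotient.map f (by
    rintro x y ⟨γ, h, h0, h1⟩
    exact ⟨f ∘ γ, hf.comp h, congrArg f h0, congrArg f h1⟩)

end PathComponents

/-! ### Loop spaces and smooth homotopy groups -/

/-- Pointed diffeological spaces. -/
structure PtSpace where
  /-- The underlying set. -/
  carrier : Type u
  /-- The diffeology. -/
  [diffeology : DiffeologicalSpace carrier]
  /-- The base point. -/
  pt : carrier

attribute [instance] PtSpace.diffeology

/-- Pointed smooth maps. -/
structure PtSpace.Hom (P : PtSpace.{u}) (Q : PtSpace.{v}) where
  /-- The underlying map. -/
  toFun : P.carrier → Q.carrier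
  smooth : DSmooth toFun
  map_pt : toFun P.pt = Q.pt

/-- The underlying set of the loop space `Ω(X, x) = C^∞((ℝ, {0, 1}), (X, x))`. -/
abbrev Loop (P : PtSpace.{u}) : Type u :=
  {f : SmoothMap ℝ P.carrier // f.1 0 = P.pt ∧ f.1 1 = P.pt}

/-- The constant loop. -/
noncomputable def Loop.const (P : PtSpace.{u}) : Loop P :=
  ⟨⟨fun _ => P.pt, dSmooth_const⟩, rfl, rfl⟩

/-- The loop space, with the sub-diffeology of the functional diffeology, pointed by the constant
loop. -/
noncomputable def loopSpace (P : PtSpace.{u}) : PtSpace.{u} where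
  carrier := Loop P
  pt := Loop.const P

/-- Composition of loops with a pointed smooth map. -/
noncomputable def loopSpaceMap {P : PtSpace.{u}} {Q : PtSpace.{v}} (f : P.Hom Q) :
    (loopSpace P).Hom (loopSpace Q) where
  toFun (γ : Loop P) : Loop Q := ⟨⟨fun t => f.toFun (γ.1.1 t), f.smooth.comp γ.1.2⟩,
    (congrArg f.toFun γ.2.1).trans f.map_pt, (congrArg f.toFun γ.2.2).trans f.map_pt⟩
  smooth := dSmooth_sub_iff.2 (dSmooth_map_iff.2 (f.smooth.comp (dSmooth_map_iff.1 dSmooth_val)))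
  map_pt := Subtype.ext (Subtype.ext (funext fun _ => f.map_pt))

/-- The iterated loop spaces `Ω^0(X, x) = (X, x)` and `Ω^(n+1)(X, x) = Ω(Ω^n(X, x))`. -/
noncomputable def iterLoop (P : PtSpace.{u}) : ℕ → PtSpace.{u}
  | 0 => P
  | (n + 1) => loopSpace (iterLoop P n)

/-- Functoriality of iterated loop spaces. -/
noncomputable def iterLoopMap {P : PtSpace.{u}} {Q : PtSpace.{v}} (f : P.Hom Q) :
    (n : ℕ) → (iterLoop P n).Hom (iterLoop Q n)
  | 0 => f
  | n + 1 => loopSpaceMap (iterLoopMap f n)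

section FundamentalGroup

variable {P : PtSpace.{u}}

theorem Loop.mk_eq_iff {f g : Loop P} : (Pi0.mk f = Pi0.mk g) ↔
    ∃ H : ℝ × ℝ → P.carrier, DSmooth H ∧ (∀ s, H (s, 0) = P.pt) ∧ (∀ s, H (s, 1) = P.pt) ∧
      (∀ t, H (0, t) = f.1.1 t) ∧ ∀ t, H (1, t) = g.1.1 t := by
  refine (Quotient.eq (r := pathSetoid (Loop P))).trans ⟨?_, ?_⟩
  · rintro ⟨F, hF, h0, h1⟩
    refine ⟨fun z => (F z.1).1.1 z.2, dSmooth_map_iff.1 (dSmooth_sub_iff.1 hF),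
      fun s => (F s).2.1, fun s => (F s).2.2, fun t => by simp only [h0], fun t => by simp only [h1]⟩
  · rintro ⟨H, hH, h0, h1, hf, hg⟩
    refine ⟨fun s => ⟨⟨fun t => H (s, t), hH.comp (dSmooth_prodMk dSmooth_const dSmooth_id)⟩,
      h0 s, h1 s⟩, dSmooth_sub_iff.2 (dSmooth_map_iff.2 hH), Subtype.ext (Subtype.ext (funext hf)),
      Subtype.ext (Subtype.ext (funext hg))⟩

/-- Smooth reparametrizations with the same end points give homotopic loops. -/
theorem Loop.mk_eq_of_reparam {f g : Loop P} {c : ℝ → P.carrier} (hc : DSmooth c) {α β : ℝ → ℝ}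
    (hα : ContDiff ℝ ∞ α) (hβ : ContDiff ℝ ∞ β) (h0 : α 0 = β 0) (h1 : α 1 = β 1)
    (hf : ∀ t, f.1.1 t = c (α t)) (hg : ∀ t, g.1.1 t = c (β t)) : Pi0.mk f = Pi0.mk g := by
  refine Loop.mk_eq_iff.2 ⟨fun z => c (α z.2 + z.1 * (β z.2 - α z.2)), ?_, ?_, ?_, ?_, ?_⟩
  · refine hc.comp (f := fun z : ℝ × ℝ => α z.2 + z.1 * (β z.2 - α z.2)) fun n p hp => ?_
    have h2 := hp.1.contDiff
    have h3 := hp.2.contDiff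
    exact ContDiff.isPlot ((hα.comp h3).add (h2.mul ((hβ.comp h3).sub (hα.comp h3))))
  · intro s
    simp only [h0, sub_self, mul_zero, add_zero]
    rw [← hg, g.2.1]
  · intro s
    simp only [h1, sub_self, mul_zero, add_zero]
    rw [← hg, g.2.2]
  · intro t; simp [hf]
  · intro t; simp [hg]

/-- Composition of loops. -/
noncomputable def Loop.mul (f g : Loop P) : Loop P :=
  ⟨⟨concat f.1.1 g.1.1, concat_dSmooth f.1.2 g.1.2 (by rw [f.2.2, g.2.1])⟩,
    by simp only [concat_zero, f.2.1], by simp only [concat_one, g.2.2]⟩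

/-- The reversed loop. -/
noncomputable def Loop.inv (f : Loop P) : Loop P :=
  ⟨⟨fun t => f.1.1 (1 - t), f.1.2.comp (f := fun t : ℝ => 1 - t) (ContDiff.dSmooth (by fun_prop))⟩,
    by simp [f.2.2], by simp [f.2.1]⟩

/-- The stationary loop `f ∘ cut`. -/
noncomputable def Loop.stat (f : Loop P) : Loop P :=
  ⟨⟨fun t => f.1.1 (cut t), f.1.2.comp cut_dSmooth⟩,
    by simp [cut_of_le, f.2.1], by
      have : cut 1 = 1 := cut_of_ge (by norm_num)
      simp [this, f.2.2]⟩

theorem Loop.mk_stat (f : Loop P) : Pi0.mk f.stat = Pi0.mk f :=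
  Loop.mk_eq_of_reparam f.1.2 cut_contDiff contDiff_id
    (by simp [cut_of_le]) (by simp [cut_of_ge (t := 1) (by norm_num)])
    (fun _ => rfl) (fun _ => rfl)

theorem Loop.mul_congr {f f' g g' : Loop P} (hf : Pi0.mk f = Pi0.mk f')
    (hg : Pi0.mk g = Pi0.mk g') : Pi0.mk (f.mul g) = Pi0.mk (f'.mul g') := by
  obtain ⟨F, hF, F0, F1, Ff, Ff'⟩ := Loop.mk_eq_iff.1 hf
  obtain ⟨G, hG, G0, G1, Gg, Gg'⟩ := Loop.mk_eq_iff.1 hg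
  refine Loop.mk_eq_iff.2 ⟨fun z => concat (fun t => F (z.1, t)) (fun t => G (z.1, t)) z.2,
    ?_, ?_, ?_, ?_, ?_⟩
  · exact concat_dSmooth_family dSmooth_snd
      (hF.comp (dSmooth_prodMk (dSmooth_fst.comp dSmooth_fst) dSmooth_snd))
      (hG.comp (dSmooth_prodMk (dSmooth_fst.comp dSmooth_fst) dSmooth_snd))
      fun y => by rw [F1, G0]
  · intro s; simp only [concat_zero, F0]
  · intro s; simp only [concat_one, G1]
  · intro t; simp only [Ff, Gg]; rfl
  · intro t; simp only [Ff', Gg']; rfl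

theorem cut_double_contDiff : ContDiff ℝ ∞ fun t : ℝ => cut (2 * t) :=
  cut_contDiff.comp (by fun_prop)

theorem cut_double_sub_contDiff : ContDiff ℝ ∞ fun t : ℝ => cut (2 * t - 1) :=
  cut_contDiff.comp (by fun_prop)

theorem Loop.one_mul (f : Loop P) : Pi0.mk ((Loop.const P).mul f) = Pi0.mk f := by
  refine Loop.mk_eq_of_reparam f.1.2 cut_double_sub_contDiff contDiff_id
    (cut_of_le (by norm_num)) (cut_of_ge (by norm_num)) (fun t => ?_)
    (fun _ => rfl)
  change concat _ _ t = _
  by_cases h : t ≤ 1 / 2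
  · simp only [concat, h, if_true]
    rw [cut_of_le (t := 2 * t - 1) (by linarith), f.2.1]; rfl
  · simp only [concat, h, if_false]

theorem Loop.mul_one (f : Loop P) : Pi0.mk (f.mul (Loop.const P)) = Pi0.mk f := by
  refine Loop.mk_eq_of_reparam f.1.2 cut_double_contDiff contDiff_id
    (cut_of_le (by norm_num)) (cut_of_ge (by norm_num)) (fun t => ?_)
    (fun _ => rfl)
  change concat _ _ t = _
  by_cases h : t ≤ 1 / 2
  · simp only [concat, h, if_true]
  · simp only [concat, h, if_false]
    rw [cut_of_ge (t := 2 * t) (by linarith), f.2.2]; rfl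

theorem Loop.inv_mul (f : Loop P) : Pi0.mk (f.inv.mul f) = Pi0.mk (Loop.const P) := by
  refine Loop.mk_eq_of_reparam (α := fun t => 1 - cut (2 * t) + cut (2 * t - 1)) (β := fun _ => 1)
    f.1.2 ((contDiff_const.sub cut_double_contDiff).add cut_double_sub_contDiff) contDiff_const
    ?_ ?_ (fun t => ?_) (fun t => f.2.2.symm)
  · rw [cut_of_le (t := 2 * 0) (by norm_num), cut_of_le (t := 2 * 0 - 1) (by norm_num)]
    norm_num
  · rw [cut_of_ge (t := 2 * 1) (by norm_num), cut_of_ge (t := 2 * 1 - 1) (by norm_num)]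
    norm_num
  change concat _ _ t = _
  by_cases h : t ≤ 1 / 2
  · simp only [concat, h, if_true]
    rw [cut_of_le (t := 2 * t - 1) (by linarith), add_zero]; rfl
  · simp only [concat, h, if_false]
    rw [cut_of_ge (t := 2 * t) (by linarith)]; simp

theorem Loop.mul_assoc (f g h : Loop P) :
    Pi0.mk ((f.mul g).mul h) = Pi0.mk (f.mul (g.mul h)) := by
  rw [Loop.mul_congr (rfl : Pi0.mk (f.mul g) = _) h.mk_stat.symm,
    Loop.mul_congr f.mk_stat.symm (rfl : Pi0.mk (g.mul h) = _)]
  let c1 : ℝ → P.carrier := fun t => if t ≤ 1 then f.1.1 (cut t) else g.1.1 (cut (t - 1))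
  let c : ℝ → P.carrier := fun t => if t ≤ 2 then c1 t else h.1.1 (cut (t - 2))
  have s1 : DSmooth fun t : ℝ => cut (t - 1) :=
    (cut_contDiff.comp (f := fun t : ℝ => t - 1) (by fun_prop)).dSmooth
  have s2 : DSmooth fun t : ℝ => cut (t - 2) :=
    (cut_contDiff.comp (f := fun t : ℝ => t - 2) (by fun_prop)).dSmooth
  have hc1 : DSmooth c1 := by
    refine dSmooth_glue (a := 2 / 3) (b := 4 / 3) (by norm_num) dSmooth_id
      (q := fun t => f.1.1 (cut t)) (r := fun t => g.1.1 (cut (t - 1)))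
      (f.1.2.comp cut_dSmooth) (g.1.2.comp s1) ?_ ?_
    · intro t (ht : t < 4 / 3)
      by_cases h' : t ≤ 1
      · simp only [c1, h', if_true]
      · simp only [c1, h', if_false]
        rw [cut_of_le (by linarith), cut_of_ge (t := t) (by linarith), f.2.2, g.2.1]
    · intro t (ht : 2 / 3 < t)
      by_cases h' : t ≤ 1
      · simp only [c1, h', if_true]
        rw [cut_of_le (t := t - 1) (by linarith), cut_of_ge (t := t) (by linarith), f.2.2, g.2.1]
      · simp only [c1, h', if_false]
  have hc : DSmooth c := by
    refine dSmooth_glue (a := 5 / 3) (b := 7 / 3) (by norm_num) dSmooth_id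
      (q := c1) (r := fun t => h.1.1 (cut (t - 2))) hc1 (h.1.2.comp s2) ?_ ?_
    · intro t (ht : t < 7 / 3)
      by_cases h' : t ≤ 2
      · simp only [c, h', if_true]
      · have h'' : ¬ t ≤ 1 := by linarith
        simp only [c, c1, h', h'', if_false]
        rw [cut_of_le (t := t - 2) (by linarith), cut_of_ge (t := t - 1) (by linarith), g.2.2,
          h.2.1]
    · intro t (ht : 5 / 3 < t)
      by_cases h' : t ≤ 2
      · have h'' : ¬ t ≤ 1 := by linarith
        simp only [c, c1, h', h'', if_true, if_false]
        rw [cut_of_le (t := t - 2) (by linarith), cut_of_ge (t := t - 1) (by linarith), g.2.2,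
          h.2.1]
      · simp only [c, h', if_false]
  have b0 : ∀ t, 0 ≤ cut t := fun t => Real.smoothTransition.nonneg _
  have b1 : ∀ t, cut t ≤ 1 := fun t => Real.smoothTransition.le_one _
  refine Loop.mk_eq_of_reparam (c := c) hc
    (α := fun t => 2 * cut (2 * t) + cut (2 * t - 1))
    (β := fun t => cut (2 * t) + 2 * cut (2 * t - 1))
    ((contDiff_const.mul cut_double_contDiff).add cut_double_sub_contDiff)
    (cut_double_contDiff.add (contDiff_const.mul cut_double_sub_contDiff)) ?_ ?_
    (fun t => ?_) (fun t => ?_)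
  · rw [cut_of_le (t := 2 * 0) (by norm_num), cut_of_le (t := 2 * 0 - 1) (by norm_num)]
    norm_num
  · rw [cut_of_ge (t := 2 * 1) (by norm_num), cut_of_ge (t := 2 * 1 - 1) (by norm_num)]
    norm_num
  · change concat (concat f.1.1 g.1.1) (fun t => h.1.1 (cut t)) t = _
    by_cases ht : t ≤ 1 / 2
    · have hz : cut (2 * t - 1) = 0 := cut_of_le (by linarith)
      have hb := b1 (2 * t)
      simp only [concat, ht, if_true, hz, add_zero, c, c1]
      rw [if_pos (show 2 * cut (2 * t) ≤ 2 by linarith)]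
      by_cases hs : cut (2 * t) ≤ 1 / 2
      · rw [if_pos hs, if_pos (by linarith)]
      · rw [if_neg hs, if_neg (by linarith)]
    · have hz : cut (2 * t) = 1 := cut_of_ge (by linarith)
      have hb := b0 (2 * t - 1)
      simp only [concat, ht, if_false, hz, c, c1]
      by_cases hs : cut (2 * t - 1) = 0
      · rw [hs, if_pos (by norm_num), if_neg (by norm_num), cut_of_le (t := 0) (by norm_num),
          cut_of_ge (t := 2 * 1 + 0 - 1) (by norm_num), g.2.2, h.2.1]
      · have := lt_of_le_of_ne hb (Ne.symm hs)
        rw [if_neg (by linarith)]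
        exact congrArg (fun r => h.1.1 (cut r)) (by ring)
  · change concat (fun t => f.1.1 (cut t)) (concat g.1.1 h.1.1) t = _
    by_cases ht : t ≤ 1 / 2
    · have hz : cut (2 * t - 1) = 0 := cut_of_le (by linarith)
      have hb := b1 (2 * t)
      simp only [concat, ht, if_true, hz, mul_zero, add_zero, c, c1]
      rw [if_pos (show cut (2 * t) ≤ 2 by linarith), if_pos hb]
    · have hz : cut (2 * t) = 1 := cut_of_ge (by linarith)
      have hb := b0 (2 * t - 1)
      simp only [concat, ht, if_false, hz, c, c1]
      by_cases hs : cut (2 * t - 1) ≤ 1 / 2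
      · rw [if_pos hs, if_pos (by linarith)]
        by_cases hs' : cut (2 * t - 1) = 0
        · rw [hs', if_pos (by norm_num), cut_of_le (t := 2 * 0) (by norm_num),
            cut_of_ge (t := 1 + 2 * 0) (by norm_num), g.2.1, f.2.2]
        · have := lt_of_le_of_ne hb (Ne.symm hs')
          rw [if_neg (by linarith)]
          exact congrArg (fun r => g.1.1 (cut r)) (by ring)
      · rw [if_neg hs, if_neg (by linarith)]
        exact congrArg (fun r => h.1.1 (cut r)) (by ring)

/-- The group `π₁^D(P)` of smooth path components of the loop space. -/
noncomputable instance groupLoop : Group (Pi0 (Loop P)) where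
  mul := Quotient.map₂ Loop.mul fun _ _ h _ _ h' =>
    Quotient.exact (Loop.mul_congr (Quotient.sound h) (Quotient.sound h'))
  one := Pi0.mk (Loop.const P)
  inv := Quotient.map Loop.inv (by
    intro f g h
    obtain ⟨H, hH, h0, h1, hf, hg⟩ := Loop.mk_eq_iff.1 (Quotient.sound h : Pi0.mk f = Pi0.mk g)
    refine Quotient.exact (Loop.mk_eq_iff.2 ⟨fun z => H (z.1, 1 - z.2), ?_, ?_, ?_, ?_, ?_⟩)
    · exact hH.comp (dSmooth_prodMk dSmooth_fst
        (DSmooth.comp (g := fun t : ℝ => 1 - t) (ContDiff.dSmooth (by fun_prop)) dSmooth_snd))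
    · intro s; simp [h1]
    · intro s; simp [h0]
    · intro t; exact hf _
    · intro t; exact hg _)
  mul_assoc a b c := by
    induction a using Quotient.inductionOn
    induction b using Quotient.inductionOn
    induction c using Quotient.inductionOn
    exact Loop.mul_assoc _ _ _
  one_mul a := by
    induction a using Quotient.inductionOn
    exact Loop.one_mul _
  mul_one a := by
    induction a using Quotient.inductionOn
    exact Loop.mul_one _
  inv_mul_cancel a := by
    induction a using Quotient.inductionOn
    exact Loop.inv_mul _

end FundamentalGroup

section HomotopyGroups

variable (n : ℕ) (X : Type u) [DiffeologicalSpace X] (x : X)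

/-- The `n`-th smooth homotopy group `π_n^D(X, x) = π₀^D(Ω^n(X, x))`. -/
noncomputable def PiD : Type u := Pi0 (iterLoop ⟨X, x⟩ n).carrier

/-- The base point of `π_n^D(X, x)`, the class of the base point of `Ω^n(X, x)`. -/
noncomputable def PiD.base : PiD n X x := Pi0.mk (iterLoop ⟨X, x⟩ n).pt

/-- For `n ≥ 1`, the group structure on `π_n^D(X, x)` given by composition of loops. -/
noncomputable instance PiD.group : Group (PiD (n + 1) X x) :=
  inferInstanceAs (Group (Pi0 (Loop (iterLoop ⟨X, x⟩ n))))

variable {X x} {Y : Type v} [DiffeologicalSpace Y] {y : Y}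

/-- The map on smooth homotopy groups induced by a pointed smooth map. -/
noncomputable def PiD.map (f : X → Y) (hf : DSmooth f) (hxy : f x = y) : PiD n X x → PiD n Y y :=
  Pi0.map _ (iterLoopMap (P := ⟨X, x⟩) (Q := ⟨Y, y⟩) ⟨f, hf, hxy⟩ n).smooth

end HomotopyGroups

end Diffeo

/-! ### Simplicial homotopy groups of Kan complexes -/

namespace SimplicialHomotopy

open CategoryTheory Simplicial Opposite MonoidalCategory CartesianMonoidalCategory SSet

section Fill

variable {X : SSet.{u}} {x : X _⦋0⦌} {n : ℕ}

/-- Horn filling: `T j l` prescribes the face of codimension two omitting the vertices `j < l`. The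
faces `G j` for `j ≠ k` have a filler, and its `k`-th face has the prescribed faces. -/
theorem exists_fill [X.KanComplex] (T : ℕ → ℕ → (Δ[n] ⟶ X)) (k : Fin (n + 3))
    (G : Fin (n + 3) → (Δ[n + 1] ⟶ X)) (H : ∀ j ≠ k, ∀ l : Fin (n + 2),
      stdSimplex.δ l ≫ G j = if (l : ℕ) < j then T l j else T j (l + 1)) :
    ∃ φ : Δ[n + 2] ⟶ X, (∀ l : Fin (n + 2),
      stdSimplex.δ l ≫ stdSimplex.δ k ≫ φ = if (l : ℕ) < k then T l k else T k (l + 1)) ∧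
      ∀ j ≠ k, stdSimplex.δ j ≫ φ = G j := by
  obtain ⟨φ, hφ⟩ := KanComplex.iff.1 ‹X.KanComplex› (i := k) (fun j _ => G j)
    (by
      rw [horn.isCompatible_iff]
      intro j l hj hl hjl
      have hjl' : (j : ℕ) < l := hjl
      rw [H j hj, H l hl, if_neg, if_pos]
      · congr 1
        simp only [Fin.val_pred]
        lia
      · simpa using hjl
      · simp only [Fin.val_pred]
        lia)
  refine ⟨φ, fun l => ?_, hφ⟩
  split_ifs with h
  · obtain ⟨k, rfl⟩ := k.eq_succ_of_ne_zero (by rintro rfl; simp at h)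
    have hl : l.castSucc ≠ k.succ := by
      intro h'; rw [← h'] at h; simp at h
    have h2 : (l : ℕ) ≤ k := by simpa [Nat.lt_succ_iff] using h
    rw [← Category.assoc, CosimplicialObject.δ_comp_δ _ h2, Category.assoc, hφ _ hl, H _ hl,
      if_neg]
    · simp
    · simpa using h2
  · obtain ⟨k, rfl⟩ := k.eq_castSucc_of_ne_last (by
      rintro rfl; simp only [Fin.val_last] at h; lia)
    have hl : l.succ ≠ k.castSucc := by
      intro h'; rw [← h'] at h; simp at h
    have h2 : (k : ℕ) ≤ l := by simpa using h
    rw [← Category.assoc, ← CosimplicialObject.δ_comp_δ _ h2, Category.assoc, hφ _ hl, H _ hl,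
      if_pos]
    · simp
    · simpa [Nat.lt_succ_iff] using h2

/-- `M i f g h` says that `h` is a product of `f` and `g` in the sense of a simplex whose faces
`i`, `i + 1`, `i + 2` are `g`, `h`, `f` and whose other faces are constant. -/
def M (i : Fin n) (f g h : X.PtSimplex n x) : Prop := Nonempty (PtSimplex.MulStruct f g h i)

theorem M_iff {i : Fin n} {f g h : X.PtSimplex n x} :
    M i f g h ↔ ∃ φ : Δ[n + 1] ⟶ X, ∀ l : Fin (n + 2), stdSimplex.δ l ≫ φ =
      if (l : ℕ) = i then g.map else if (l : ℕ) = i + 1 then h.map else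
        if (l : ℕ) = i + 2 then f.map else SSet.const x := by
  constructor
  · rintro ⟨m⟩
    refine ⟨m.map, fun l => ?_⟩
    split_ifs with h0 h1 h2
    · obtain rfl : l = i.castSucc.castSucc := Fin.ext h0
      exact m.δ_castSucc_castSucc_map
    · obtain rfl : l = i.castSucc.succ := Fin.ext h1
      exact m.δ_succ_castSucc_map
    · obtain rfl : l = i.succ.succ := Fin.ext h2
      exact m.δ_succ_succ_map
    · rcases lt_or_ge (l : ℕ) i with h | h
      · exact m.δ_map_of_lt l h
      · exact m.δ_map_of_gt l (by rw [Fin.lt_def]; simp only [Fin.val_succ]; lia)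
  · rintro ⟨φ, hφ⟩
    refine ⟨⟨φ, by simp [hφ], by simp [hφ], by simp [hφ, Nat.add_assoc], fun j hj => ?_, fun j hj => ?_⟩⟩
    · have : (j : ℕ) < i := hj
      rw [hφ, if_neg (by lia), if_neg (by lia), if_neg (by lia)]
    · have : (i : ℕ) + 2 < j := by simpa [Fin.lt_def] using hj
      rw [hφ, if_neg (by lia), if_neg (by lia), if_neg (by lia)]

/-- A simplex with constant faces is constant on the boundary. -/
def ofFaces (g : Δ[n + 1] ⟶ X) (hg : ∀ l : Fin (n + 2), stdSimplex.δ l ≫ g = SSet.const x) :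
    X.PtSimplex (n + 1) x where
  map := g
  comm := boundary.hom_ext fun i => by
    rw [← Category.assoc, boundary.ι_ι, hg]
    simp

/-- The codimension two faces in a configuration of six pointed simplices, thought of as the edges
of a tetrahedron on the vertices `0, 1, 2, 3`. -/
def table (i : ℕ) (f01 f12 f23 f02 f13 f03 : X.PtSimplex n x) (j l : ℕ) : Δ[n] ⟶ X :=
  if j = i ∧ l = i + 1 then f23.map else
  if j = i ∧ l = i + 2 then f13.map else
  if j = i ∧ l = i + 3 then f12.map else
  if j = i + 1 ∧ l = i + 2 then f03.map else
  if j = i + 1 ∧ l = i + 3 then f02.map else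
  if j = i + 2 ∧ l = i + 3 then f01.map else SSet.const x

theorem table_of_ne {i : ℕ} {f01 f12 f23 f02 f13 f03 : X.PtSimplex n x} {j l : ℕ}
    (h : (j < i ∨ i + 3 < j) ∨ (l < i ∨ i + 3 < l)) :
    table i f01 f12 f23 f02 f13 f03 j l = SSet.const x := by
  simp only [table]
  split_ifs <;> first | rfl | lia

section Tetrahedron

variable {i : Fin n} {f01 f12 f23 f02 f13 f03 : X.PtSimplex n x}

/-- The faces of the face of a tetrahedron opposite to a vertex. -/
abbrev HasFaces (i : Fin n) (f01 f12 f23 f02 f13 f03 : X.PtSimplex n x) (j : ℕ) : Prop :=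
  ∃ g : Δ[n + 1] ⟶ X, ∀ l : Fin (n + 2), stdSimplex.δ l ≫ g =
    if (l : ℕ) < j then table i f01 f12 f23 f02 f13 f03 l j
    else table i f01 f12 f23 f02 f13 f03 j (l + 1)

theorem hasFaces_iff {j : ℕ} {f g h : X.PtSimplex n x}
    (H : ∀ l : ℕ, (if l < j then table i f01 f12 f23 f02 f13 f03 l j
      else table i f01 f12 f23 f02 f13 f03 j (l + 1)) =
        if l = i then g.map else if l = i + 1 then h.map else
        if l = i + 2 then f.map else SSet.const x) :
    HasFaces i f01 f12 f23 f02 f13 f03 j ↔ M i f g h := by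
  rw [M_iff]
  simp only [HasFaces, H]

theorem hasFaces_zero : HasFaces i f01 f12 f23 f02 f13 f03 i ↔ M i f12 f23 f13 :=
  hasFaces_iff fun l => by
    simp only [table]
    split_ifs <;> first | rfl | lia

theorem hasFaces_one : HasFaces i f01 f12 f23 f02 f13 f03 (i + 1) ↔ M i f02 f23 f03 :=
  hasFaces_iff fun l => by
    simp only [table]
    split_ifs <;> first | rfl | lia

theorem hasFaces_two : HasFaces i f01 f12 f23 f02 f13 f03 (i + 2) ↔ M i f01 f13 f03 :=
  hasFaces_iff fun l => by
    simp only [table]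
    split_ifs <;> first | rfl | lia

theorem hasFaces_three : HasFaces i f01 f12 f23 f02 f13 f03 (i + 3) ↔ M i f01 f12 f02 :=
  hasFaces_iff fun l => by
    simp only [table]
    split_ifs <;> first | rfl | lia

theorem hasFaces_const {j : ℕ} (hj : j < i ∨ i + 3 < j) : HasFaces i f01 f12 f23 f02 f13 f03 j :=
  ⟨SSet.const x, fun l => by
    rw [table_of_ne (Or.inr hj), table_of_ne (Or.inl hj), ite_self]; simp⟩

theorem hasFaces_of_others [X.KanComplex] (k : ℕ) (hk : k < n + 3)
    (H : ∀ j, j ≠ k → (j = i ∨ j = i + 1 ∨ j = i + 2 ∨ j = i + 3) →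
      HasFaces i f01 f12 f23 f02 f13 f03 j) : HasFaces i f01 f12 f23 f02 f13 f03 k := by
  have H' : ∀ j : Fin (n + 3), ∃ g : Δ[n + 1] ⟶ X, j ≠ ⟨k, hk⟩ → ∀ l : Fin (n + 2),
      stdSimplex.δ l ≫ g = if (l : ℕ) < j then table i f01 f12 f23 f02 f13 f03 l j
        else table i f01 f12 f23 f02 f13 f03 j (l + 1) := by
    intro j
    by_cases hj : j = ⟨k, hk⟩
    · exact ⟨SSet.const x, fun h => absurd hj h⟩
    · by_cases h : (j : ℕ) = i ∨ (j : ℕ) = i + 1 ∨ (j : ℕ) = i + 2 ∨ (j : ℕ) = i + 3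
      · obtain ⟨g, hg⟩ := H j (fun h' => hj (Fin.ext h')) h
        exact ⟨g, fun _ => hg⟩
      · obtain ⟨g, hg⟩ := hasFaces_const (i := i) (f01 := f01) (f12 := f12) (f23 := f23)
          (f02 := f02) (f13 := f13) (f03 := f03) (j := j) (by lia)
        exact ⟨g, fun _ => hg⟩
  choose G hG using H'
  obtain ⟨φ, h, -⟩ := exists_fill (table i f01 f12 f23 f02 f13 f03) ⟨k, hk⟩ G hG
  exact ⟨_, h⟩

variable [X.KanComplex]

theorem M_023 (h012 : M i f01 f12 f02) (h123 : M i f12 f23 f13) (h013 : M i f01 f13 f03) :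
    M i f02 f23 f03 := by
  rw [← hasFaces_one (f01 := f01) (f12 := f12) (f13 := f13)]
  refine hasFaces_of_others _ (by lia) ?_
  rintro j hj (rfl | rfl | rfl | rfl)
  exacts [hasFaces_zero.2 h123, absurd rfl hj, hasFaces_two.2 h013, hasFaces_three.2 h012]

theorem M_013 (h012 : M i f01 f12 f02) (h123 : M i f12 f23 f13) (h023 : M i f02 f23 f03) :
    M i f01 f13 f03 := by
  rw [← hasFaces_two (f12 := f12) (f23 := f23) (f02 := f02)]
  refine hasFaces_of_others _ (by lia) ?_
  rintro j hj (rfl | rfl | rfl | rfl)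
  exacts [hasFaces_zero.2 h123, hasFaces_one.2 h023, absurd rfl hj, hasFaces_three.2 h012]

theorem M_012 (h123 : M i f12 f23 f13) (h023 : M i f02 f23 f03) (h013 : M i f01 f13 f03) :
    M i f01 f12 f02 := by
  rw [← hasFaces_three (f23 := f23) (f13 := f13) (f03 := f03)]
  refine hasFaces_of_others _ (by lia) ?_
  rintro j hj (rfl | rfl | rfl | rfl)
  exacts [hasFaces_zero.2 h123, hasFaces_one.2 h023, hasFaces_two.2 h013, absurd rfl hj]

end Tetrahedron

/-! ### The calculus of products -/

theorem M_one_left (i : Fin n) (f : X.PtSimplex n x) : M i .const f f := ⟨.oneMul f i⟩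

theorem M_one_right (i : Fin n) (f : X.PtSimplex n x) : M i f .const f := ⟨.mulOne f i⟩

section

variable [X.KanComplex] {i : Fin n} {f f' g g' h h' : X.PtSimplex n x}

theorem M_right_of_left (H : M i .const f g) : M i g .const f :=
  M_023 H (M_one_right i f) (M_one_left i f)

theorem M_left_of_right (H : M i g .const f) : M i .const f g :=
  M_012 (M_one_right i f) H (M_one_left i f)

theorem M_symm (H : M i .const f g) : M i .const g f :=
  M_013 (M_one_left i _) H (M_one_left i f)

theorem M_trans (H : M i .const f g) (H' : M i .const g h) : M i .const f h :=
  M_023 (M_one_left i _) H H'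

theorem M_congr_prod (H : M i f g h) (H' : M i .const h h') : M i f g h' :=
  M_023 (M_one_left i f) H H'

theorem M_unique (H : M i f g h) (H' : M i f g h') : M i .const h h' :=
  M_013 (M_one_left i f) H H'

theorem M_congr_left (H : M i f g h) (H' : M i .const f f') : M i f' g h :=
  M_023 H' H (M_one_left i h)

theorem M_congr_right (H : M i f g h) (H' : M i .const g g') : M i f g' h :=
  M_012 (M_right_of_left H') (M_one_right i h) H

end

/-- Filling a horn all of whose faces are constant on the boundary. -/
theorem exists_fill_pt [X.KanComplex] (F : Fin (n + 3) → X.PtSimplex (n + 1) x)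
    (k : Fin (n + 3)) : ∃ (φ : Δ[n + 2] ⟶ X) (g : X.PtSimplex (n + 1) x), ∀ l : Fin (n + 3),
      stdSimplex.δ l ≫ φ = if l = k then g.map else (F l).map := by
  obtain ⟨φ, h, h'⟩ := exists_fill (fun _ _ => SSet.const x) k (fun j => (F j).map) fun j _ l => by
    rw [PtSimplex.δ_map, ite_self]
  refine ⟨φ, ofFaces (stdSimplex.δ k ≫ φ) fun l => by rw [h, ite_self], fun l => ?_⟩
  split_ifs with hl
  · subst hl; rfl
  · exact h' l hl

theorem exists_M [X.KanComplex] (i : Fin (n + 1)) (f g : X.PtSimplex (n + 1) x) :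
    ∃ h, M i f g h := by
  obtain ⟨φ, h, H⟩ := exists_fill_pt (fun l => if (l : ℕ) = i then g else
    if (l : ℕ) = i + 2 then f else .const) i.castSucc.succ
  refine ⟨h, M_iff.2 ⟨φ, fun l => ?_⟩⟩
  rw [H]
  simp only [Fin.ext_iff, Fin.val_succ, Fin.val_castSucc]
  split_ifs <;> first | rfl | lia

theorem exists_M_right [X.KanComplex] (i : Fin (n + 1)) (f h : X.PtSimplex (n + 1) x) :
    ∃ g, M i f g h := by
  obtain ⟨φ, g, H⟩ := exists_fill_pt (fun l => if (l : ℕ) = i + 1 then h else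
    if (l : ℕ) = i + 2 then f else .const) i.castSucc.castSucc
  refine ⟨g, M_iff.2 ⟨φ, fun l => ?_⟩⟩
  rw [H]
  simp only [Fin.ext_iff, Fin.val_castSucc]
  split_ifs <;> rfl

/-- The relation `M i 1 f g` does not depend on `i`. -/
theorem M_index [X.KanComplex] {f g : X.PtSimplex (n + 1) x} (i j : Fin (n + 1)) :
    M i .const f g ↔ M j .const f g := by
  have key : ∀ i : Fin (n + 1), M i .const f g ↔ M 0 .const f g := by
    intro i
    induction i using Fin.induction with
    | zero => rfl
    | succ i ih =>
      rw [← ih]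
      constructor
      · rintro ⟨m⟩
        have r := PtSimplex.relStructCastSuccEquivMulStruct.symm m
        exact M_left_of_right ⟨PtSimplex.relStructSuccEquivMulStruct (i := i.castSucc) r⟩
      · intro m
        obtain ⟨m⟩ := M_right_of_left m
        have r := PtSimplex.relStructSuccEquivMulStruct.symm m
        exact ⟨PtSimplex.relStructCastSuccEquivMulStruct (i := i.succ) r⟩
  rw [key i, key j]

theorem M_of_relStruct [X.KanComplex] {f g : X.PtSimplex (n + 1) x} {i : Fin (n + 2)}
    (r : PtSimplex.RelStruct f g i) (j : Fin (n + 1)) : M j .const f g := by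
  induction i using Fin.lastCases with
  | last =>
    rw [← Fin.succ_last] at r
    rw [M_index j (Fin.last n)]
    exact M_left_of_right ⟨PtSimplex.relStructSuccEquivMulStruct r⟩
  | cast i =>
    rw [M_index j i]
    exact ⟨PtSimplex.relStructCastSuccEquivMulStruct r⟩

/-! ### Comparison with simplicial homotopies -/

theorem homotopy_comp_const {f g : X.PtSimplex n x} (H : f.Homotopy g) {Z : SSet.{u}}
    (a : Z ⟶ Δ[n]) (b : Z ⟶ Δ[1]) (ha : Subcomplex.range a ≤ boundary n) :
    lift a b ≫ H.h = SSet.const x := by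
  have h : lift a b = lift (Subcomplex.lift a ha) b ≫ (boundary n).ι ▷ Δ[1] := by
    ext <;> rfl
  rw [h, Category.assoc, H.rel]
  rfl

/-- The intermediate stages of a homotopy along the prism. -/
def stage {f g : X.PtSimplex n x} (H : f.Homotopy g) (k : Fin (n + 2)) : X.PtSimplex n x where
  map := lift (𝟙 _) (SSet.yonedaEquiv.symm (stdSimplex.objMk₁ k)) ≫ H.h
  comm := by
    rw [← Category.assoc]
    have h : (boundary n).ι ≫ lift (𝟙 _) (SSet.yonedaEquiv.symm (stdSimplex.objMk₁ k)) =
      lift (boundary n).ι ((boundary n).ι ≫ (SSet.yonedaEquiv.symm (stdSimplex.objMk₁ k))) := rfl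
    rw [h, homotopy_comp_const H _ _ (by simp)]
    rfl

theorem range_le_boundary_of_comp {m : ℕ} (s : Δ[m + 1] ⟶ Δ[n + 1]) (j : Fin (m + 2))
    (i : Fin (n + 2)) (r : Δ[m] ⟶ Δ[n]) (h : stdSimplex.δ j ≫ s = r ≫ stdSimplex.δ i) :
    Subcomplex.range (stdSimplex.δ j ≫ s) ≤ boundary (n + 1) := by
  rw [h, ← boundary.ι_ι, ← Category.assoc]
  intro m z hz
  obtain ⟨w, rfl⟩ := hz
  exact (((r ≫ boundary.ι i).app m) w).2

theorem δ_σ_range (i : Fin (n + 1)) (j : Fin (n + 2)) (h : j < i.castSucc ∨ i.succ < j) :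
    Subcomplex.range (stdSimplex.{u}.δ j ≫ stdSimplex.σ i) ≤ boundary n := by
  obtain _ | n := n
  · exfalso
    fin_cases i
    rcases h with h | h
    · simp at h
    · fin_cases j <;> simp at h
  · rcases h with h | h
    · obtain ⟨i, rfl⟩ := i.eq_succ_of_ne_zero (by rintro rfl; simp at h)
      obtain ⟨j, rfl⟩ := j.eq_castSucc_of_ne_last (by
        rintro rfl; exact absurd h (not_lt.2 (Fin.le_last _)))
      exact range_le_boundary_of_comp _ _ j (stdSimplex.σ i)
        (CosimplicialObject.δ_comp_σ_of_le _ (by grind))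
    · obtain ⟨i, rfl⟩ := i.eq_castSucc_of_ne_last (by
        rintro rfl; exact absurd h (not_lt.2 (Fin.le_last _)))
      obtain ⟨j, rfl⟩ := j.eq_succ_of_ne_zero (by rintro rfl; simp at h)
      exact range_le_boundary_of_comp _ _ j (stdSimplex.σ i)
        (CosimplicialObject.δ_comp_σ_of_gt _ (by grind))

/-- The simplices of the prism relate the successive stages of a homotopy. -/
def stageRel {f g : X.PtSimplex n x} (H : f.Homotopy g) (i : Fin (n + 1)) :
    PtSimplex.RelStruct (stage H i.castSucc) (stage H i.succ) i where
  map := lift (stdSimplex.σ i) (SSet.yonedaEquiv.symm (stdSimplex.objMk₁ i.succ.castSucc)) ≫ H.h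
  δ_castSucc_map := by
    have h : stdSimplex.δ i.castSucc ≫
      lift (stdSimplex.σ i) (SSet.yonedaEquiv.symm (stdSimplex.objMk₁ i.succ.castSucc)) =
        lift (stdSimplex.δ i.castSucc ≫ stdSimplex.σ i) (stdSimplex.δ i.castSucc ≫
          (SSet.yonedaEquiv.symm (stdSimplex.objMk₁ i.succ.castSucc))) := rfl
    rw [← Category.assoc, h, CosimplicialObject.δ_comp_σ_self, stdSimplex.δ_comp_yonedaEquiv_symm,
      stdSimplex.δ_objMk₁_of_lt _ _ (by simp [Fin.lt_def])]
    rfl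
  δ_succ_map := by
    have h : stdSimplex.δ i.succ ≫
      lift (stdSimplex.σ i) (SSet.yonedaEquiv.symm (stdSimplex.objMk₁ i.succ.castSucc)) =
        lift (stdSimplex.δ i.succ ≫ stdSimplex.σ i) (stdSimplex.δ i.succ ≫
          (SSet.yonedaEquiv.symm (stdSimplex.objMk₁ i.succ.castSucc))) := rfl
    rw [← Category.assoc, h, CosimplicialObject.δ_comp_σ_succ, stdSimplex.δ_comp_yonedaEquiv_symm,
      stdSimplex.δ_objMk₁_of_le _ _ (by simp)]
    rfl
  δ_map_of_lt j hj := by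
    have h : stdSimplex.δ j ≫
      lift (stdSimplex.σ i) (SSet.yonedaEquiv.symm (stdSimplex.objMk₁ i.succ.castSucc)) =
        lift (stdSimplex.δ j ≫ stdSimplex.σ i) (stdSimplex.δ j ≫
          (SSet.yonedaEquiv.symm (stdSimplex.objMk₁ i.succ.castSucc))) := rfl
    rw [← Category.assoc, h, homotopy_comp_const H _ _ (δ_σ_range i j (Or.inl hj))]
  δ_map_of_gt j hj := by
    have h : stdSimplex.δ j ≫
      lift (stdSimplex.σ i) (SSet.yonedaEquiv.symm (stdSimplex.objMk₁ i.succ.castSucc)) =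
        lift (stdSimplex.δ j ≫ stdSimplex.σ i) (stdSimplex.δ j ≫
          (SSet.yonedaEquiv.symm (stdSimplex.objMk₁ i.succ.castSucc))) := rfl
    rw [← Category.assoc, h, homotopy_comp_const H _ _ (δ_σ_range i j (Or.inr hj))]

theorem stage_zero {f g : X.PtSimplex n x} (H : f.Homotopy g) : stage H 0 = g := by
  ext1
  rw [← H.h₁]
  have h : SSet.yonedaEquiv.symm (stdSimplex.objMk₁ (n := n) 0) =
    SSet.const (stdSimplex.obj₀Equiv.{u}.symm 1) := by
    rw [Equiv.symm_apply_eq]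
    ext j
    rfl
  simp only [stage, h]
  rfl

theorem stage_last {f g : X.PtSimplex n x} (H : f.Homotopy g) : stage H (Fin.last _) = f := by
  ext1
  rw [← H.h₀]
  have h : SSet.yonedaEquiv.symm (stdSimplex.objMk₁ (n := n) (Fin.last _)) =
    SSet.const (stdSimplex.obj₀Equiv.{u}.symm 0) := by
    rw [Equiv.symm_apply_eq]
    ext j
    rw [stdSimplex.objMk₁_of_castSucc_lt _ _ (Fin.castSucc_lt_last _)]
    rfl
  simp only [stage, h]
  rfl

theorem M_of_homotopy [X.KanComplex] {f g : X.PtSimplex (n + 1) x} (H : f.Homotopy g)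
    (j : Fin (n + 1)) : M j .const f g := by
  have key : ∀ k : Fin (n + 3), M j .const (stage H 0) (stage H k) := by
    intro k
    induction k using Fin.induction with
    | zero => exact M_one_left _ _
    | succ k ih => exact M_trans ih (M_of_relStruct (stageRel H k) j)
  have := key (Fin.last _)
  rw [stage_zero, stage_last] at this
  exact M_symm this

/-- The retraction of the prism onto its last simplex, `(a, b) ↦ a` unless `a` is the last vertex
and `b = 1`. -/
def prismMap (n : ℕ) : (Δ[n] ⊗ Δ[1] : SSet.{u}) ⟶ Δ[n + 1] where
  app U := TypeCat.ofHom fun s => stdSimplex.objMk (n := ⦋n + 1⦌)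
    { toFun := fun k => if stdSimplex.asOrderHom s.1 k = Fin.last n ∧
        stdSimplex.asOrderHom s.2 k = 1 then Fin.last (n + 1)
        else (stdSimplex.asOrderHom s.1 k).castSucc
      monotone' := fun k l h => by
        have h1 := (stdSimplex.asOrderHom s.1).monotone h
        have h2 := (stdSimplex.asOrderHom s.2).monotone h
        dsimp only
        split_ifs with h3 h4 h4
        · exact le_rfl
        · exfalso
          rw [h3.1, Fin.last_le_iff] at h1
          rw [h3.2] at h2
          exact h4 ⟨h1, le_antisymm (Fin.le_last _) h2⟩
        · exact Fin.le_last _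
        · exact h1 }
  naturality U V φ := by
    ext s
    rfl

theorem exists_δ_app {m : ℕ} (p : Fin (n + 2)) (t : (Δ[n + 1] : SSet.{u}) _⦋m⦌)
    (h : ∀ k, t k ≠ p) : ∃ t' : (Δ[n] : SSet.{u}) _⦋m⦌, (stdSimplex.δ p).app _ t' = t := by
  have ht : t ∈ (stdSimplex.face {p}ᶜ).obj _ := by simpa using h
  rw [stdSimplex.face_singleton_compl, Subcomplex.mem_ofSimplex_obj_iff] at ht
  obtain ⟨f, hf⟩ := ht
  exact ⟨stdSimplex.objEquiv.symm f, hf⟩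

theorem ι₀_prismMap : ι₀ ≫ prismMap.{u} n = stdSimplex.δ (Fin.last n).succ := by
  apply SSet.yonedaEquiv.injective
  ext k : 1
  change (if k = Fin.last n ∧ (0 : Fin 2) = 1 then Fin.last (n + 1) else k.castSucc) =
    (Fin.last n).succ.succAbove k
  rw [if_neg (by simp), Fin.succ_last, Fin.succAbove_last]

theorem ι₁_prismMap : ι₁ ≫ prismMap.{u} n = stdSimplex.δ (Fin.last n).castSucc := by
  apply SSet.yonedaEquiv.injective
  ext k : 1
  change (if k = Fin.last n ∧ (1 : Fin 2) = 1 then Fin.last (n + 1) else k.castSucc) =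
    (Fin.last n).castSucc.succAbove k
  by_cases h : k = Fin.last n
  · subst h
    rw [if_pos (by simp), Fin.succAbove_of_le_castSucc _ _ le_rfl, Fin.succ_last]
  · rw [if_neg (by simp [h]), Fin.succAbove_of_castSucc_lt _ _ (by
      rw [Fin.castSucc_lt_castSucc_iff]; exact Fin.lt_last_iff_ne_last.2 h)]

theorem app_δ_of_eq_const {p : Fin (n + 2)} {φ : Δ[n + 1] ⟶ X}
    (h : stdSimplex.δ p ≫ φ = SSet.const x) {m : ℕ} (t' : (Δ[n] : SSet.{u}) _⦋m⦌) :
    φ.app _ ((stdSimplex.δ p).app _ t') = (SSet.const (X := Δ[n]) x).app _ t' := by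
  rw [← h]; rfl

/-- A pair of simplices related by `PtSimplex.RelStruct` is homotopic. -/
def homotopyOfRelStruct {f g : X.PtSimplex n x} (r : PtSimplex.RelStruct f g (Fin.last n)) :
    g.Homotopy f where
  h := prismMap n ≫ r.map
  h₀ := by rw [← r.δ_succ_map, ← Category.assoc, ι₀_prismMap]
  h₁ := by rw [← r.δ_castSucc_map, ← Category.assoc, ι₁_prismMap]
  rel := by
    ext ⟨⟨m⟩⟩ ⟨⟨s, hs⟩, b⟩
    obtain ⟨j, hj⟩ := (mem_boundary_iff_notMem_range s).1 hs
    have hj' : ∀ k, s k ≠ j := fun k hk => hj ⟨k, hk⟩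
    change r.map.app _ ((prismMap n).app _ (s, b)) = (SSet.const (X := Δ[n]) x).app _ s
    have happ : ∀ k : Fin (m + 1), ((prismMap.{u} n).app (op ⦋m⦌) (s, b) : Δ[n + 1] _⦋m⦌) k =
      if s k = Fin.last n ∧ b k = 1 then Fin.last (n + 1) else (s k).castSucc := fun k => rfl
    by_cases hl : j = Fin.last n
    · subst hl
      have h : (prismMap.{u} n).app (op ⦋m⦌) (s, b) = (stdSimplex.δ (Fin.last n).succ).app _ s := by
        rw [← ι₀_prismMap]
        refine DFunLike.ext (F := (Δ[n + 1] : SSet.{u}) _⦋m⦌) _ _ fun k => ?_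
        refine (happ k).trans ?_
        rw [if_neg (fun h => hj' k h.1)]
        change _ = if s k = Fin.last n ∧ (0 : Fin 2) = 1 then Fin.last (n + 1) else (s k).castSucc
        rw [if_neg (by simp)]
      rw [h]
      have h2 := ConcreteCategory.congr_hom (congr_app r.δ_succ_map (op ⦋m⦌)) s
      refine Eq.trans h2 ?_
      exact RelativeMorphism.map_eq_of_mem g s hs
    · obtain ⟨t', ht'⟩ := exists_δ_app j.castSucc
        ((prismMap.{u} n).app (op ⦋m⦌) (s, b) : Δ[n + 1] _⦋m⦌) (fun k => by
          rw [happ]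
          split_ifs with h
          · exact (Fin.castSucc_lt_last j).ne'
          · exact fun h => hj' k (Fin.castSucc_injective _ h))
      rw [← ht', app_δ_of_eq_const (r.δ_map_of_lt _ (by
        rw [Fin.castSucc_lt_castSucc_iff]; exact Fin.lt_last_iff_ne_last.2 hl))]
      rfl

/-! ### The group structure -/

/-- The `n`-th simplicial homotopy group: homotopy classes, relative to the boundary, of maps
`Δ[n] ⟶ X` sending the boundary to `x`. -/
def PiS (X : SSet.{u}) (x : X _⦋0⦌) (n : ℕ) : Type u :=
  RelativeMorphism.HomotopyClass (boundary n) (Subcomplex.ofSimplex x)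
    (SSet.const ⟨x, Subcomplex.mem_ofSimplex_obj x⟩)

/-- The class of a pointed simplex. -/
def PiS.mk (f : X.PtSimplex n x) : PiS X x n := f.homotopyClass

theorem PiS.mk_surjective (a : PiS X x n) : ∃ f, PiS.mk f = a := a.eq_homotopyClass

theorem PiS.mk_eq_iff [X.KanComplex] {f g : X.PtSimplex (n + 1) x} (i : Fin (n + 1)) :
    PiS.mk f = PiS.mk g ↔ M i .const f g := by
  constructor
  · intro h
    have h' := Quot.eqvGen_exact h
    clear h
    induction h' with
    | rel f g h => exact M_of_homotopy h.some i
    | refl f => exact M_one_left _ _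
    | symm f g _ ih => exact M_symm ih
    | trans f g k _ _ ih ih' => exact M_trans ih ih'
  · intro h
    obtain ⟨m⟩ := M_right_of_left ((M_index i (Fin.last n)).1 h)
    have r := PtSimplex.relStructSuccEquivMulStruct.symm m
    exact (homotopyOfRelStruct r).eq.symm

variable (X x n) in
/-- The base point of `π_n^s(X, x)`, the class of the constant simplex. -/
def PiS.base : PiS X x n := PiS.mk .const

section Group

variable [X.KanComplex]

/-- A representative of the product of the classes of `f` and `g`: the `n`-th face of an
`(n + 1)`-simplex whose faces `n - 1` and `n + 1` are `f` and `g`, and whose other faces are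
constant (for simplices of dimension `n`). -/
noncomputable def mulRep (f g : X.PtSimplex (n + 1) x) : X.PtSimplex (n + 1) x :=
  (exists_M (Fin.last n) g f).choose

theorem mulRep_spec (f g : X.PtSimplex (n + 1) x) : M (Fin.last n) g f (mulRep f g) :=
  (exists_M (Fin.last n) g f).choose_spec

/-- The product is independent of the choices. -/
theorem mulRep_congr {f f' g g' h h' : X.PtSimplex (n + 1) x} (hf : PiS.mk f = PiS.mk f')
    (hg : PiS.mk g = PiS.mk g') (H : M (Fin.last n) g f h) (H' : M (Fin.last n) g' f' h') :
    PiS.mk h = PiS.mk h' :=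
  (PiS.mk_eq_iff (Fin.last n)).2 (M_unique (M_congr_left (M_congr_right H
    ((PiS.mk_eq_iff _).1 hf)) ((PiS.mk_eq_iff _).1 hg)) H')

noncomputable instance : Mul (PiS X x (n + 1)) where
  mul := Quot.lift₂ (fun f g => PiS.mk (mulRep f g))
    (fun _ _ _ h => mulRep_congr rfl (Quot.sound h) (mulRep_spec _ _) (mulRep_spec _ _))
    (fun _ _ _ h => mulRep_congr (Quot.sound h) rfl (mulRep_spec _ _) (mulRep_spec _ _))

/-- The characterization of the product. -/
theorem PiS.mk_mul_mk {f g h : X.PtSimplex (n + 1) x} (H : M (Fin.last n) g f h) :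
    PiS.mk f * PiS.mk g = PiS.mk h :=
  mulRep_congr rfl rfl (mulRep_spec f g) H

theorem PiS.exists_inv (a : PiS X x (n + 1)) : ∃ b, b * a = PiS.mk .const := by
  obtain ⟨f, rfl⟩ := a.mk_surjective
  obtain ⟨g, hg⟩ := exists_M_right (Fin.last n) f (.const : X.PtSimplex (n + 1) x)
  exact ⟨PiS.mk g, PiS.mk_mul_mk hg⟩

/-- The group structure on the simplicial homotopy groups of a Kan complex. -/
noncomputable instance groupPiS : Group (PiS X x (n + 1)) where
  mul_assoc a b c := by
    obtain ⟨f, rfl⟩ := a.mk_surjective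
    obtain ⟨g, rfl⟩ := b.mk_surjective
    obtain ⟨k, rfl⟩ := c.mk_surjective
    obtain ⟨p, hp⟩ := exists_M (Fin.last n) g f
    obtain ⟨q, hq⟩ := exists_M (Fin.last n) k p
    obtain ⟨r, hr⟩ := exists_M (Fin.last n) k g
    rw [PiS.mk_mul_mk hp, PiS.mk_mul_mk hq, PiS.mk_mul_mk hr, PiS.mk_mul_mk (M_023 hr hp hq)]
  one := PiS.base X x (n + 1)
  one_mul a := by
    obtain ⟨f, rfl⟩ := a.mk_surjective
    exact PiS.mk_mul_mk (M_one_right _ f)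
  mul_one a := by
    obtain ⟨f, rfl⟩ := a.mk_surjective
    exact PiS.mk_mul_mk (M_one_left _ f)
  inv a := (PiS.exists_inv a).choose
  inv_mul_cancel a := (PiS.exists_inv a).choose_spec

end Group

/-- The map on simplicial homotopy groups induced by a pointed map. -/
def PiS.map {Y : SSet.{u}} {y : Y _⦋0⦌} (φ : X ⟶ Y) (h : φ.app _ x = y) (n : ℕ) :
    PiS X x n → PiS Y y n := fun a =>
  RelativeMorphism.HomotopyClass.postcomp a (RelativeMorphism.ofSimplex₀ φ x y h) (by
    rfl)

end Fill
end SimplicialHomotopy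

/-! ### The smooth singular simplicial set -/

namespace Diffeo

open Diffeology CategoryTheory Opposite
open scoped Simplicial ContDiff

/-- The non-compact simplex `𝔸ⁿ = {(x₀, …, xₙ) ∈ ℝⁿ⁺¹ | ∑ xᵢ = 1}`, with the sub-diffeology. -/
abbrev AffSimplex (n : ℕ) : Type :=
  {v : EuclideanSpace ℝ (Fin (n + 1)) // ∑ i, v i = 1}

/-- The affine map `𝔸ᵐ → 𝔸ⁿ` induced by a map `θ` on vertices: the `j`-th coordinate of the image
of `v` is the sum of the `v i` with `θ i = j`. -/
noncomputable def AffSimplex.map {m n : ℕ} (θ : Fin (m + 1) → Fin (n + 1)) (v : AffSimplex m) :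
    AffSimplex n :=
  ⟨WithLp.toLp 2 fun j => ∑ i with θ i = j, v.1 i, by
    simpa using (Finset.sum_fiberwise Finset.univ θ fun i => v.1 i).trans v.2⟩

theorem AffSimplex.map_dSmooth {m n : ℕ} (θ : Fin (m + 1) → Fin (n + 1)) :
    DSmooth (AffSimplex.map θ) := by
  refine dSmooth_sub_iff.2 (DSmooth.comp
    (g := fun v : EuclideanSpace ℝ (Fin (m + 1)) =>
      (WithLp.toLp 2 fun j => ∑ i with θ i = j, v i : EuclideanSpace ℝ (Fin (n + 1))))
    (ContDiff.dSmooth ?_) dSmooth_val)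
  rw [contDiff_euclidean]
  intro j
  change ContDiff ℝ ∞ fun v : EuclideanSpace ℝ (Fin (m + 1)) => ∑ i with θ i = j, v i
  exact ContDiff.sum fun i _ => contDiff_euclidean.1
    (contDiff_id : ContDiff ℝ ∞ (id : EuclideanSpace ℝ (Fin (m + 1)) → _)) i

theorem AffSimplex.map_id {n : ℕ} (v : AffSimplex n) : AffSimplex.map id v = v := by
  ext j
  simp [AffSimplex.map, Finset.sum_filter]

theorem AffSimplex.map_comp {l m n : ℕ} (θ : Fin (l + 1) → Fin (m + 1))
    (η : Fin (m + 1) → Fin (n + 1)) (v : AffSimplex l) :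
    AffSimplex.map (η ∘ θ) v = AffSimplex.map η (AffSimplex.map θ v) := by
  ext j
  change ∑ i with η (θ i) = j, v.1 i = ∑ k with η k = j, ∑ i with θ i = k, v.1 i
  rw [← Finset.sum_fiberwise_of_maps_to (s := Finset.univ.filter fun i => η (θ i) = j)
    (t := Finset.univ.filter fun k => η k = j) (g := θ) (by simp)]
  refine Finset.sum_congr rfl fun k hk => Finset.sum_congr ?_ fun _ _ => rfl
  ext i
  simp only [Finset.mem_filter, Finset.mem_univ, true_and] at hk ⊢
  exact ⟨fun h => h.2, fun h => ⟨h ▸ hk, h⟩⟩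

/-- The smooth singular simplicial set `S^D(X)`, with `S^D_n(X) = C^∞(𝔸ⁿ, X)`. -/
noncomputable def smoothSing (X : Type u) [DiffeologicalSpace X] : SSet.{u} where
  obj m := SmoothMap (AffSimplex m.unop.len) X
  map θ := TypeCat.ofHom fun f =>
    ⟨fun v => f.1 (AffSimplex.map θ.unop.toOrderHom v), f.2.comp (AffSimplex.map_dSmooth _)⟩
  map_id _ := ConcreteCategory.hom_ext _ _ fun f => Subtype.ext (funext fun v =>
    congrArg (Subtype.val (p := DSmooth) f) (AffSimplex.map_id v))
  map_comp θ η := ConcreteCategory.hom_ext _ _ fun f => Subtype.ext (funext fun v =>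
    congrArg (Subtype.val (p := DSmooth) f)
      (AffSimplex.map_comp η.unop.toOrderHom θ.unop.toOrderHom v))

/-- A point of `X`, as a `0`-simplex of `S^D(X)`. -/
noncomputable def vertex {X : Type u} [DiffeologicalSpace X] (x : X) : smoothSing X _⦋0⦌ :=
  (⟨fun _ => x, dSmooth_const⟩ : SmoothMap (AffSimplex 0) X)

/-- Functoriality of the smooth singular simplicial set. -/
noncomputable def smoothSingMap {X Y : Type u} [DiffeologicalSpace X] [DiffeologicalSpace Y]
    (f : X → Y) (hf : DSmooth f) : smoothSing X ⟶ smoothSing Y where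
  app _ := TypeCat.ofHom fun s => ⟨fun v => f (s.1 v), hf.comp s.2⟩
  naturality _ _ _ := rfl

theorem smoothSingMap_vertex {X Y : Type u} [DiffeologicalSpace X] [DiffeologicalSpace Y]
    {f : X → Y} (hf : DSmooth f) {x : X} {y : Y} (hxy : f x = y) :
    (smoothSingMap f hf).app _ (vertex x) = vertex y :=
  Subtype.ext (funext fun _ => hxy)

end Diffeo

/-! Both sides are compared with the smooth path components of `simplexSpace P n`, the space of
smooth maps from `𝔸ⁿ` that are constant at the base point on every hyperplane `v j = 0`.

By Yoneda, the points of this space are the pointed `n`-simplices of `S^D(X)`. A smooth path in it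
is a simplicial homotopy, with a barycentric coordinate of `Δ[1]` as time. Conversely, the prism
decomposition cuts a simplicial homotopy into `(n + 1)`-simplices with at most two nonconstant
faces, which are adjacent. Sliding the weight of one vertex between two adjacent vertices sweeps out
a smooth path joining those faces. Hence `piSToPi0_bijective`.

Dividing the last coordinate of `v : 𝔸ⁿ` into `s * v n` and `(1 - s) * v n` turns a pointed `(n +
1)`-simplex into a loop of pointed `n`-simplices (`toLoop`). An inverse has to recover `s` as a
quotient of coordinates, which is singular where the divided coordinate vanishes. Squeezing
simplices so that they are constant on a collar of each face removes the singularity: on the collar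
the value of `s` is irrelevant. Squeezing moves points along lines that preserve the faces, so it is
homotopic to the identity, and `toLoop` is a pointed smooth homotopy equivalence (`toLoop_isEquiv`).
Iteration gives `toIterLoop_isEquiv`, and a homotopy equivalence induces a bijection on path
components.

For the products, a simplex witnessing that `h` is the product of `f` and `g` gives a smooth family
of pointed simplices over the plane. The loops of `f`, `g` and `h` run along the sides of a triangle
there, and a straight-line homotopy deforms the first two sides into the third (`toLoop_mul_eq`).
Naturality holds because the comparison precomposes simplices with fixed maps, which commutes with
postcomposition by `f`. -/

namespace Diffeo

open Diffeology
open scoped ContDiff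

/-! ### Pointed smooth homotopy equivalences -/

namespace PtSpace

variable {P : PtSpace.{u}} {Q : PtSpace.{v}} {R : PtSpace.{w}}

@[ext]
theorem Hom.ext {f g : P.Hom Q} (h : ∀ a, f.toFun a = g.toFun a) : f = g := by
  obtain ⟨f, _, _⟩ := f
  obtain ⟨g, _, _⟩ := g
  obtain rfl : f = g := funext h
  rfl

/-- The identity. -/
def Hom.id (P : PtSpace.{u}) : P.Hom P := ⟨fun a => a, dSmooth_id', rfl⟩

/-- Composition of pointed smooth maps. -/
def Hom.comp (g : Q.Hom R) (f : P.Hom Q) : P.Hom R :=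
  ⟨fun a => g.toFun (f.toFun a), g.smooth.comp f.smooth,
    (congrArg g.toFun f.map_pt).trans g.map_pt⟩

/-- Pointed smooth maps are homotopic if they are joined by a smooth family of pointed maps
parametrized by the real line. -/
def Hom.Homotopic (f g : P.Hom Q) : Prop :=
  ∃ H : P.carrier → ℝ → Q.carrier, (DSmooth fun z : P.carrier × ℝ => H z.1 z.2) ∧
    (∀ s, H P.pt s = Q.pt) ∧ (∀ a, H a 0 = f.toFun a) ∧ ∀ a, H a 1 = g.toFun a

namespace Hom.Homotopic

theorem of_eq {f g : P.Hom Q} (h : ∀ a, f.toFun a = g.toFun a) : f.Homotopic g :=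
  ⟨fun a _ => f.toFun a, f.smooth.comp dSmooth_fst, fun _ => f.map_pt, fun _ => rfl, h⟩

theorem trans {f g h : P.Hom Q} (H : f.Homotopic g) (K : g.Homotopic h) : f.Homotopic h := by
  obtain ⟨H, hs, hp, h0, h1⟩ := H
  obtain ⟨K, ks, kp, k0, k1⟩ := K
  refine ⟨fun a s => concat (H a) (K a) s, ?_, fun s => ?_, fun a => ?_, fun a => ?_⟩
  · exact concat_dSmooth_family dSmooth_snd
      (hs.comp (dSmooth_prodMk (dSmooth_fst.comp dSmooth_fst) dSmooth_snd))
      (ks.comp (dSmooth_prodMk (dSmooth_fst.comp dSmooth_fst) dSmooth_snd))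
      fun y => by rw [h1, k0]
  · simp only [concat, hp, kp, ite_self]
  · exact (concat_zero _ _).trans (h0 a)
  · exact (concat_one _ _).trans (k1 a)

theorem comp_left {f g : P.Hom Q} (H : f.Homotopic g) (k : Q.Hom R) :
    (k.comp f).Homotopic (k.comp g) := by
  obtain ⟨H, hs, hp, h0, h1⟩ := H
  exact ⟨fun a s => k.toFun (H a s), k.smooth.comp hs,
    fun s => (congrArg k.toFun (hp s)).trans k.map_pt, fun a => congrArg k.toFun (h0 a),
    fun a => congrArg k.toFun (h1 a)⟩

theorem comp_right {f g : Q.Hom R} (H : f.Homotopic g) (k : P.Hom Q) :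
    (f.comp k).Homotopic (g.comp k) := by
  obtain ⟨H, hs, hp, h0, h1⟩ := H
  exact ⟨fun a s => H (k.toFun a) s,
    hs.comp (dSmooth_prodMk (k.smooth.comp dSmooth_fst) dSmooth_snd),
    fun s => (congrArg (H · s) k.map_pt).trans (hp s), fun a => h0 _, fun a => h1 _⟩

/-- A pointed homotopy keeps the end points of a loop at the base point at every time, so it can be
applied pointwise. By cartesian closedness, smoothness reduces to that of `H (γ t) s` in all three
variables. -/
theorem loopSpaceMap {f g : P.Hom Q} (H : f.Homotopic g) :
    (loopSpaceMap f).Homotopic (loopSpaceMap g) := by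
  obtain ⟨H, hs, hp, h0, h1⟩ := H
  have h (s : ℝ) : DSmooth fun a => H a s := hs.comp (dSmooth_prodMk dSmooth_id' dSmooth_const)
  refine ⟨fun (γ : Loop P) s => (⟨⟨fun t => H (γ.1.1 t) s, (h s).comp γ.1.2⟩,
    (congrArg (H · s) γ.2.1).trans (hp s), (congrArg (H · s) γ.2.2).trans (hp s)⟩ : Loop Q),
    dSmooth_sub_iff.2 (dSmooth_map_iff.2 ?_),
    fun s => Subtype.ext (Subtype.ext (funext fun _ => hp s)),
    fun γ => Subtype.ext (Subtype.ext (funext fun _ => h0 _)),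
    fun γ => Subtype.ext (Subtype.ext (funext fun _ => h1 _))⟩
  refine hs.comp (dSmooth_prodMk (DSmooth.comp (f := fun z : (Loop P × ℝ) × ℝ => (z.1.1, z.2))
    (dSmooth_map_iff.1 dSmooth_val) ?_) (dSmooth_snd.comp dSmooth_fst))
  exact dSmooth_prodMk (dSmooth_fst.comp dSmooth_fst) dSmooth_snd

end Hom.Homotopic

/-- Pointed smooth homotopy equivalences. -/
def Hom.IsEquiv (f : P.Hom Q) : Prop :=
  ∃ g : Q.Hom P, (g.comp f).Homotopic (.id P) ∧ (f.comp g).Homotopic (.id Q)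

namespace Hom.IsEquiv

theorem comp {g : Q.Hom R} {f : P.Hom Q} (hg : g.IsEquiv) (hf : f.IsEquiv) :
    (g.comp f).IsEquiv := by
  obtain ⟨f', hf, hf'⟩ := hf
  obtain ⟨g', hg, hg'⟩ := hg
  exact ⟨f'.comp g', ((hg.comp_right f).comp_left f').trans hf,
    ((hf'.comp_right g').comp_left g).trans hg'⟩

theorem loopSpaceMap {f : P.Hom Q} (hf : f.IsEquiv) : (loopSpaceMap f).IsEquiv := by
  obtain ⟨f', hf, hf'⟩ := hf
  exact ⟨Diffeo.loopSpaceMap f', hf.loopSpaceMap, hf'.loopSpaceMap⟩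

end Hom.IsEquiv

/-- The map induced on smooth path components. -/
def Hom.pi0 (f : P.Hom Q) : Pi0 P.carrier → Pi0 Q.carrier := Pi0.map f.toFun f.smooth

theorem Hom.Homotopic.pi0_eq {f g : P.Hom Q} (H : f.Homotopic g) : f.pi0 = g.pi0 := by
  obtain ⟨H, hs, -, h0, h1⟩ := H
  funext a
  induction a using Quotient.inductionOn with
  | h a => exact Quotient.sound ⟨fun s => H a s,
      hs.comp (dSmooth_prodMk dSmooth_const dSmooth_id'), h0 a, h1 a⟩

theorem Hom.pi0_id (a : Pi0 P.carrier) : (Hom.id P).pi0 a = a := by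
  induction a using Quotient.inductionOn
  rfl

theorem Hom.pi0_comp (g : Q.Hom R) (f : P.Hom Q) (a : Pi0 P.carrier) :
    (g.comp f).pi0 a = g.pi0 (f.pi0 a) := by
  induction a using Quotient.inductionOn
  rfl

theorem Hom.IsEquiv.pi0_bijective {f : P.Hom Q} (hf : f.IsEquiv) : Function.Bijective f.pi0 := by
  obtain ⟨g, h, h'⟩ := hf
  refine Function.bijective_iff_has_inverse.2 ⟨g.pi0, fun a => ?_, fun a => ?_⟩
  · rw [← Hom.pi0_comp, h.pi0_eq, Hom.pi0_id]
  · rw [← Hom.pi0_comp, h'.pi0_eq, Hom.pi0_id]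

end PtSpace

end Diffeo

namespace Diffeo

open Diffeology
open scoped ContDiff

/-! ### Affine simplices -/

section RealFunctions

variable {Z : Type u} [DiffeologicalSpace Z] {f g : Z → ℝ}

theorem dSmooth_add (hf : DSmooth f) (hg : DSmooth g) : DSmooth fun z => f z + g z :=
  fun n p hp => ContDiff.isPlot ((hf n p hp).contDiff.add (hg n p hp).contDiff)

theorem dSmooth_sub (hf : DSmooth f) (hg : DSmooth g) : DSmooth fun z => f z - g z :=
  fun n p hp => ContDiff.isPlot ((hf n p hp).contDiff.sub (hg n p hp).contDiff)

theorem dSmooth_mul (hf : DSmooth f) (hg : DSmooth g) : DSmooth fun z => f z * g z :=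
  fun n p hp => ContDiff.isPlot ((hf n p hp).contDiff.mul (hg n p hp).contDiff)

theorem dSmooth_div (hf : DSmooth f) (hg : DSmooth g) (h : ∀ z, g z ≠ 0) :
    DSmooth fun z => f z / g z :=
  fun n p hp => ContDiff.isPlot ((hf n p hp).contDiff.div (hg n p hp).contDiff fun t => h (p t))

theorem dSmooth_sum {ι : Type*} (s : Finset ι) {F : ι → Z → ℝ} (h : ∀ i ∈ s, DSmooth (F i)) :
    DSmooth fun z => ∑ i ∈ s, F i z :=
  fun n p hp => ContDiff.isPlot (ContDiff.sum (f := fun i => F i ∘ p)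
    fun i hi => (h i hi n p hp).contDiff)

end RealFunctions

namespace AffSimplex

variable {Z : Type u} [DiffeologicalSpace Z] {m n : ℕ}

theorem dSmooth_iff {f : Z → AffSimplex n} : DSmooth f ↔ ∀ j, DSmooth fun z => (f z).1 j := by
  constructor
  · intro h j k p hp
    exact ContDiff.isPlot (contDiff_euclidean.1 (IsPlot.contDiff (h k p hp)) j)
  · intro h k p hp
    exact isPlot_sub_iff.2 (ContDiff.isPlot (contDiff_euclidean.2 fun j => (h j k p hp).contDiff))

theorem coord_dSmooth (j : Fin (n + 1)) : DSmooth fun v : AffSimplex n => v.1 j :=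
  dSmooth_iff.1 dSmooth_id' j

/-- The points of the line through two points of an affine simplex. -/
noncomputable def mix (s : ℝ) (v w : AffSimplex n) : AffSimplex n :=
  ⟨WithLp.toLp 2 fun j => s * v.1 j + (1 - s) * w.1 j, by
    simp [Finset.sum_add_distrib, ← Finset.mul_sum, v.2, w.2]⟩

theorem mix_apply (s : ℝ) (v w : AffSimplex n) (j : Fin (n + 1)) :
    (mix s v w).1 j = s * v.1 j + (1 - s) * w.1 j := rfl

theorem mix_zero (v w : AffSimplex n) : mix 0 v w = w := by
  ext j
  simp [mix_apply]

theorem mix_one (v w : AffSimplex n) : mix 1 v w = v := by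
  ext j
  simp [mix_apply]

theorem mix_dSmooth {s : Z → ℝ} {v w : Z → AffSimplex n} (hs : DSmooth s) (hv : DSmooth v)
    (hw : DSmooth w) : DSmooth fun z => mix (s z) (v z) (w z) :=
  dSmooth_iff.2 fun j => dSmooth_add (dSmooth_mul hs (dSmooth_iff.1 hv j))
    (dSmooth_mul (dSmooth_sub dSmooth_const hs) (dSmooth_iff.1 hw j))

theorem map_apply (θ : Fin (m + 1) → Fin (n + 1)) (v : AffSimplex m) (j : Fin (n + 1)) :
    (map θ v).1 j = ∑ i with θ i = j, v.1 i := rfl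

theorem map_apply_of_injective {θ : Fin (m + 1) → Fin (n + 1)} (hθ : Function.Injective θ)
    (v : AffSimplex m) (i : Fin (m + 1)) : (map θ v).1 (θ i) = v.1 i := by
  rw [map_apply, Finset.sum_eq_single i]
  · intro k hk hki
    exact absurd (hθ (Finset.mem_filter.1 hk).2) hki
  · intro h
    simp at h

theorem map_apply_of_notMem {θ : Fin (m + 1) → Fin (n + 1)} (v : AffSimplex m) {j : Fin (n + 1)}
    (h : ∀ i, θ i ≠ j) : (map θ v).1 j = 0 := by
  rw [map_apply]
  exact Finset.sum_eq_zero fun i hi => absurd (Finset.mem_filter.1 hi).2 (h i)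

/-- Deleting a vanishing coordinate preserves the sum. This turns the vanishing of a coordinate into
membership in a simplicial face, where the face identities of a simplex apply. -/
theorem exists_map_succAbove {j : Fin (n + 2)} {v : AffSimplex (n + 1)} (h : v.1 j = 0) :
    ∃ w : AffSimplex n, map j.succAbove w = v ∧ ∀ i, w.1 i = v.1 (j.succAbove i) := by
  have hs : ∑ i, v.1 (j.succAbove i) = 1 := by
    have := v.2
    rwa [Fin.sum_univ_succAbove _ j, h, zero_add] at this
  refine ⟨⟨WithLp.toLp 2 fun i => v.1 (j.succAbove i), hs⟩, ?_, fun i => rfl⟩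
  ext k
  by_cases hk : k = j
  · subst hk
    rw [map_apply_of_notMem _ fun i => k.succAbove_ne i, h]
  · obtain ⟨i, rfl⟩ := Fin.exists_succAbove_eq hk
    rw [map_apply_of_injective Fin.succAbove_right_injective]

/-- The point of `𝔸ⁿ⁺¹` obtained from a point of `𝔸ⁿ` by dividing the coordinate of the vertex `i`
between the vertices `i` and `i + 1`. -/
noncomputable def split (i : Fin (n + 1)) (s : ℝ) (v : AffSimplex n) : AffSimplex (n + 1) :=
  mix s (map i.succ.succAbove v) (map i.castSucc.succAbove v)

theorem split_zero (i : Fin (n + 1)) (v : AffSimplex n) :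
    split i 0 v = map i.castSucc.succAbove v := mix_zero _ _

theorem split_one (i : Fin (n + 1)) (v : AffSimplex n) :
    split i 1 v = map i.succ.succAbove v := mix_one _ _

theorem split_dSmooth (i : Fin (n + 1)) {s : Z → ℝ} {v : Z → AffSimplex n} (hs : DSmooth s)
    (hv : DSmooth v) : DSmooth fun z => split i (s z) (v z) :=
  mix_dSmooth hs ((map_dSmooth _).comp hv) ((map_dSmooth _).comp hv)

theorem split_castSucc (i : Fin (n + 1)) (s : ℝ) (v : AffSimplex n) :
    (split i s v).1 i.castSucc = s * v.1 i := by
  have h := map_apply_of_injective (θ := i.succ.succAbove) Fin.succAbove_right_injective v i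
  rw [Fin.succAbove_succ_self] at h
  rw [split, mix_apply, h, map_apply_of_notMem v fun k => Fin.succAbove_ne i.castSucc k]
  ring

theorem split_succ (i : Fin (n + 1)) (s : ℝ) (v : AffSimplex n) :
    (split i s v).1 i.succ = (1 - s) * v.1 i := by
  have h := map_apply_of_injective (θ := i.castSucc.succAbove) Fin.succAbove_right_injective v i
  rw [Fin.succAbove_castSucc_self] at h
  rw [split, mix_apply, h, map_apply_of_notMem v fun k => Fin.succAbove_ne i.succ k]
  ring

theorem split_of_ne {i k : Fin (n + 1)} (h : k ≠ i) (s : ℝ) (v : AffSimplex n) :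
    (split i s v).1 (i.castSucc.succAbove k) = v.1 k := by
  have h1 := map_apply_of_injective (θ := i.castSucc.succAbove) Fin.succAbove_right_injective v k
  have h2 := map_apply_of_injective (θ := i.succ.succAbove) Fin.succAbove_right_injective v k
  -- The two face inclusions mixed in `split` differ only at the vertex `i`.
  have h3 : i.succ.succAbove k = i.castSucc.succAbove k := by
    rcases lt_or_gt_of_ne h with h | h
    · rw [Fin.succAbove_of_castSucc_lt _ _ (Fin.castSucc_lt_castSucc_iff.2 h),
        Fin.succAbove_of_castSucc_lt _ _ ((Fin.castSucc_lt_castSucc_iff.2 h).trans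
          Fin.castSucc_lt_succ)]
    · rw [Fin.succAbove_of_lt_succ _ _ (Fin.succ_lt_succ_iff.2 h),
        Fin.succAbove_of_le_castSucc _ _ (Fin.castSucc_le_castSucc_iff.2 h.le)]
  rw [h3] at h2
  rw [split, mix_apply, h1, h2]
  ring

theorem map_mix (θ : Fin (m + 1) → Fin (n + 1)) (s : ℝ) (v w : AffSimplex m) :
    map θ (mix s v w) = mix s (map θ v) (map θ w) := by
  ext j
  simp only [mix_apply, map_apply, Finset.sum_add_distrib, Finset.mul_sum]

/-- Merging the vertices `i` and `i + 1` retracts both face inclusions and is affine, so it also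
undoes their mixtures. -/
theorem map_predAbove_split (i : Fin (n + 1)) (s : ℝ) (v : AffSimplex n) :
    map i.predAbove (split i s v) = v := by
  have h1 : i.predAbove ∘ i.succ.succAbove = id := funext fun k => by
    rcases le_or_gt k i with h | h
    · rw [Function.comp_apply, Fin.succAbove_of_castSucc_lt _ _ (Fin.castSucc_lt_succ_iff.2 h),
        Fin.predAbove_castSucc_of_le _ _ h, id]
    · rw [Function.comp_apply, Fin.succAbove_of_lt_succ _ _ (Fin.succ_lt_succ_iff.2 h),
        Fin.predAbove_succ_of_le _ _ h.le, id]
  have h2 : i.predAbove ∘ i.castSucc.succAbove = id := funext fun k => by simp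
  rw [split, map_mix, ← map_comp, ← map_comp, h1, h2, map_id]
  ext j
  rw [mix_apply]
  ring

/-! ### Squeezing simplices -/

/-- The coordinates may be negative, but the largest is at least their average. This keeps the
denominator of `squeeze` away from zero. -/
theorem exists_coord_ge (v : AffSimplex n) : ∃ i, 1 / (n + 1 : ℝ) ≤ v.1 i := by
  by_contra! h
  have := Finset.sum_lt_sum_of_nonempty Finset.univ_nonempty fun i (_ : i ∈ Finset.univ) => h i
  rw [v.2, Finset.sum_const, Finset.card_univ, Fintype.card_fin, nsmul_eq_mul] at this
  push_cast at this
  rw [mul_one_div_cancel (by positivity)] at this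
  exact lt_irrefl _ this

/-- The width of the collar on which squeezing is constant in one direction. -/
noncomputable def collar (n : ℕ) : ℝ := 1 / (n + 2)

theorem collar_pos (n : ℕ) : 0 < collar n := by
  unfold collar
  positivity

/-- A cut-off function vanishing precisely on the collar of the boundary. -/
noncomputable def bump (n : ℕ) (t : ℝ) : ℝ := Real.smoothTransition (t - collar n)

theorem bump_dSmooth (n : ℕ) : DSmooth (bump n) :=
  (Real.smoothTransition.contDiff.comp (f := fun t : ℝ => t - collar n) (by fun_prop)).dSmooth

theorem bump_of_le {t : ℝ} (h : t ≤ collar n) : bump n t = 0 :=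
  Real.smoothTransition.zero_of_nonpos (by linarith)

theorem sum_bump_ne_zero (v : AffSimplex n) : ∑ i, bump n (v.1 i) ≠ 0 := by
  obtain ⟨i, hi⟩ := v.exists_coord_ge
  -- The collar has width `1 / (n + 2)`, strictly below the bound `1 / (n + 1)`, so some coordinate
  -- has a positive bump.
  have h : collar n < v.1 i := by
    refine lt_of_lt_of_le ?_ hi
    unfold collar
    gcongr
    norm_num
  exact (Finset.sum_pos' (fun j _ => Real.smoothTransition.nonneg _)
    ⟨i, Finset.mem_univ i, Real.smoothTransition.pos_of_pos (by linarith)⟩).ne'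

/-- The smooth map contracting a collar of each face to that face. -/
noncomputable def squeeze (v : AffSimplex n) : AffSimplex n :=
  ⟨WithLp.toLp 2 fun j => bump n (v.1 j) / ∑ i, bump n (v.1 i), by
    simp [← Finset.sum_div, div_self v.sum_bump_ne_zero]⟩

theorem squeeze_dSmooth : DSmooth (squeeze : AffSimplex n → AffSimplex n) :=
  dSmooth_iff.2 fun j => dSmooth_div ((bump_dSmooth n).comp (coord_dSmooth j))
    (dSmooth_sum _ fun i _ => (bump_dSmooth n).comp (coord_dSmooth i)) sum_bump_ne_zero

/-- The condition is one-sided: the whole half-space beyond the face, with negative coordinates, is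
sent to the face as well. -/
theorem squeeze_of_le {v : AffSimplex n} {j : Fin (n + 1)} (h : v.1 j ≤ collar n) :
    v.squeeze.1 j = 0 := by
  change bump n (v.1 j) / _ = 0
  rw [bump_of_le h, zero_div]

theorem squeeze_of_eq_zero {v : AffSimplex n} {j : Fin (n + 1)} (h : v.1 j = 0) :
    v.squeeze.1 j = 0 := squeeze_of_le (h.le.trans (collar_pos n).le)

/-- A smooth function on the line which agrees with the inverse outside of the collar. -/
noncomputable def recip (n : ℕ) (t : ℝ) : ℝ :=
  t / (t ^ 2 + (1 - Real.smoothTransition (t / collar n)))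

theorem recip_dSmooth (n : ℕ) : DSmooth (recip n) := by
  have h : ContDiff ℝ ∞ fun t : ℝ => Real.smoothTransition (t / collar n) :=
    Real.smoothTransition.contDiff.comp (f := fun t : ℝ => t / collar n) (by fun_prop)
  refine (contDiff_id.div ((contDiff_id.pow 2).add (contDiff_const.sub h)) fun t => ?_).dSmooth
  -- Both summands of the denominator are nonnegative. At `t = 0` the cut-off vanishes and the
  -- second one is `1`; elsewhere `t ^ 2` is positive.
  have h1 := Real.smoothTransition.le_one (t / collar n)
  by_cases ht : t = 0
  · subst ht
    simp
  · have : 0 < t ^ 2 := by positivity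
    simp only [id_eq]
    linarith

theorem recip_of_ge {t : ℝ} (h : collar n ≤ t) : recip n t = t⁻¹ := by
  have hc := collar_pos n
  rw [recip, Real.smoothTransition.one_of_one_le ((one_le_div hc).2 h)]
  have : t ≠ 0 := by linarith
  field_simp
  simp

end AffSimplex

end Diffeo

namespace Diffeo

open Diffeology
open scoped ContDiff

/-! ### Coordinates after merging or splitting vertices -/

namespace AffSimplex

variable {n : ℕ}

theorem map_predAbove_apply (i k : Fin (n + 1)) (v : AffSimplex (n + 1)) :
    (map i.predAbove v).1 k =
      v.1 (i.castSucc.succAbove k) + if k = i then v.1 i.castSucc else 0 := by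
  rw [map_apply, Finset.sum_filter, Fin.sum_univ_succAbove _ i.castSucc]
  simp [Fin.predAbove_succAbove, add_comm, eq_comm]

/-- The vertices after a splitting are the two copies of `i` and those that are left untouched. -/
theorem eq_castSucc_or_succAbove (i : Fin (n + 1)) (j : Fin (n + 2)) :
    j = i.castSucc ∨ j = i.succ ∨ ∃ k ≠ i, j = i.castSucc.succAbove k := by
  by_cases h : j = i.castSucc
  · exact Or.inl h
  · obtain ⟨k, rfl⟩ := Fin.exists_succAbove_eq h
    by_cases hk : k = i
    · subst hk
      exact Or.inr (Or.inl (Fin.succAbove_castSucc_self _))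
    · exact Or.inr (Or.inr ⟨k, hk, rfl⟩)

/-- Splitting takes faces into faces for every real `s`, so the loop attached to a pointed simplex
consists of pointed simplices. -/
theorem split_eq_zero (i : Fin (n + 1)) {s : ℝ} {v : AffSimplex n} {j : Fin (n + 1)}
    (h : v.1 j = 0) : ∃ k, (split i s v).1 k = 0 := by
  by_cases hj : j = i
  · subst hj
    exact ⟨j.castSucc, by rw [split_castSucc, h, mul_zero]⟩
  · exact ⟨_, (split_of_ne hj s v).trans h⟩

theorem coord_eq_one (v : AffSimplex 0) (j : Fin 1) : v.1 j = 1 := by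
  rw [Subsingleton.elim j 0]
  exact (Fin.sum_univ_one _).symm.trans v.2

end AffSimplex

/-! ### Spaces of pointed simplices -/

variable {P : PtSpace.{u}} {Q : PtSpace.{v}} {n : ℕ}

/-- The underlying set of the space of pointed simplices. -/
abbrev PtSimplices (P : PtSpace.{u}) (n : ℕ) : Type u :=
  {f : SmoothMap (AffSimplex n) P.carrier // ∀ (v : AffSimplex n) (j : Fin (n + 1)),
    v.1 j = 0 → f.1 v = P.pt}

/-- The space of the smooth simplices whose faces are constant at the base point. -/
noncomputable def simplexSpace (P : PtSpace.{u}) (n : ℕ) : PtSpace.{u} where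
  carrier := PtSimplices P n
  pt := ⟨⟨fun _ => P.pt, dSmooth_const⟩, fun _ _ _ => rfl⟩

theorem eval_dSmooth : DSmooth fun z : PtSimplices P n × AffSimplex n => z.1.1.1 z.2 :=
  dSmooth_map_iff.1 dSmooth_val

theorem Loop.eval_dSmooth : DSmooth fun z : Loop P × ℝ => z.1.1.1 z.2 :=
  dSmooth_map_iff.1 dSmooth_val

/-- Functoriality of the space of pointed simplices. -/
noncomputable def simplexSpaceMap (f : P.Hom Q) (n : ℕ) :
    (simplexSpace P n).Hom (simplexSpace Q n) where
  toFun (σ : PtSimplices P n) : PtSimplices Q n := ⟨⟨fun v => f.toFun (σ.1.1 v),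
    f.smooth.comp σ.1.2⟩, fun v j h => (congrArg f.toFun (σ.2 v j h)).trans f.map_pt⟩
  smooth := dSmooth_sub_iff.2 (dSmooth_map_iff.2 (f.smooth.comp eval_dSmooth))
  map_pt := Subtype.ext (Subtype.ext (funext fun _ => f.map_pt))

/-! ### Pointed simplices and loops of pointed simplices -/

/-- A pointed simplex of dimension `n + 1`, as a loop of pointed simplices of dimension `n`. -/
noncomputable def toLoop (P : PtSpace.{u}) (n : ℕ) :
    (simplexSpace P (n + 1)).Hom (loopSpace (simplexSpace P n)) where
  toFun (σ : PtSimplices P (n + 1)) : Loop (simplexSpace P n) :=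
    ⟨⟨fun s => (⟨⟨fun v => σ.1.1 (.split (Fin.last n) s v),
      σ.1.2.comp (AffSimplex.split_dSmooth _ dSmooth_const dSmooth_id')⟩, fun v j h => by
        obtain ⟨k, hk⟩ := AffSimplex.split_eq_zero (Fin.last n) (s := s) h
        exact σ.2 _ k hk⟩ : PtSimplices P n),
      dSmooth_sub_iff.2 (dSmooth_map_iff.2 (σ.1.2.comp
        (AffSimplex.split_dSmooth _ dSmooth_fst dSmooth_snd)))⟩,
      -- At `s = 0` and `s = 1` one of the two shares vanishes, so the whole simplex lies in a face
      -- of `σ`.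
      Subtype.ext (Subtype.ext (funext fun v => σ.2 _ (Fin.last n).castSucc (by
        rw [AffSimplex.split_castSucc, zero_mul]))),
      Subtype.ext (Subtype.ext (funext fun v => σ.2 _ (Fin.last n).succ (by
        rw [AffSimplex.split_succ, sub_self, zero_mul])))⟩
  smooth := by
    refine dSmooth_sub_iff.2 (dSmooth_map_iff.2 (dSmooth_sub_iff.2 (dSmooth_map_iff.2 ?_)))
    refine DSmooth.comp (f := fun z : (PtSimplices P (n + 1) × ℝ) × AffSimplex n =>
      (z.1.1, AffSimplex.split (Fin.last n) z.1.2 z.2)) eval_dSmooth ?_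
    exact dSmooth_prodMk (dSmooth_fst.comp dSmooth_fst)
      (AffSimplex.split_dSmooth _ (dSmooth_snd.comp dSmooth_fst) dSmooth_snd)
  map_pt := rfl

/-- The proportion in which the sum of the last two coordinates of a point of `𝔸ⁿ⁺¹` is divided
between them, made smooth inside the collar. -/
noncomputable def AffSimplex.ratio (v : AffSimplex (n + 1)) : ℝ :=
  v.1 (Fin.last n).castSucc * recip n ((map (Fin.last n).predAbove v).1 (Fin.last n))

theorem AffSimplex.ratio_dSmooth : DSmooth (ratio : AffSimplex (n + 1) → ℝ) :=
  dSmooth_mul (coord_dSmooth _) ((recip_dSmooth n).comp ((coord_dSmooth _).comp (map_dSmooth _)))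

/-- On a face of `𝔸ⁿ⁺¹`, either the loop parameter is an end point or the squeezed point lies on a
face; in both cases `ofLoop` takes the base point as value. The index `j` is recorded because
`toLoop_isEquiv` needs each face to be mapped to itself. -/
theorem AffSimplex.face_cases {v : AffSimplex (n + 1)} {j : Fin (n + 2)} (h : v.1 j = 0) :
    (j = (Fin.last n).castSucc ∧ v.ratio = 0) ∨ (j = (Fin.last n).succ ∧ v.ratio = 1) ∨
      ∃ k, (map (Fin.last n).predAbove v).squeeze.1 k = 0 ∧
        (j = (Fin.last n).castSucc.succAbove k) := by
  obtain rfl | rfl | ⟨k, hk, rfl⟩ := eq_castSucc_or_succAbove (Fin.last n) j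
  · exact Or.inl ⟨rfl, by rw [ratio, h, zero_mul]⟩
  · have hx : (map (Fin.last n).predAbove v).1 (Fin.last n) = v.1 (Fin.last n).castSucc := by
      rw [map_predAbove_apply, Fin.succAbove_castSucc_self, h, if_pos rfl, zero_add]
    -- The merged coordinate equals the share of the first vertex. Outside the collar `recip` is the
    -- true inverse and the ratio is `1`; inside, it need not be, but squeezing sends the merged
    -- coordinate to `0`.
    rcases le_or_gt (v.1 (Fin.last n).castSucc) (collar n) with h' | h'
    · exact Or.inr (Or.inr ⟨Fin.last n, squeeze_of_le (hx.le.trans h'),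
        (Fin.succAbove_castSucc_self _).symm⟩)
    · refine Or.inr (Or.inl ⟨rfl, ?_⟩)
      rw [ratio, hx, recip_of_ge h'.le, mul_inv_cancel₀ ((collar_pos n).trans h').ne']
  · refine Or.inr (Or.inr ⟨k, squeeze_of_eq_zero ?_, rfl⟩)
    rw [map_predAbove_apply, h, if_neg hk, zero_add]

/-- The homotopy inverse of `toLoop`. -/
noncomputable def ofLoop (P : PtSpace.{u}) (n : ℕ) :
    (loopSpace (simplexSpace P n)).Hom (simplexSpace P (n + 1)) where
  toFun (γ : Loop (simplexSpace P n)) : PtSimplices P (n + 1) :=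
    ⟨⟨fun v => (γ.1.1 v.ratio : PtSimplices P n).1.1 (v.map (Fin.last n).predAbove).squeeze,
      (dSmooth_map_iff.1 (dSmooth_sub_iff.1 γ.1.2)).comp (dSmooth_prodMk AffSimplex.ratio_dSmooth
        (AffSimplex.squeeze_dSmooth.comp (AffSimplex.map_dSmooth _)))⟩, fun v j h => by
      rcases AffSimplex.face_cases h with ⟨-, h⟩ | ⟨-, h⟩ | ⟨k, h, -⟩
      · simp only [h, γ.2.1]
        rfl
      · simp only [h, γ.2.2]
        rfl
      · exact (γ.1.1 v.ratio : PtSimplices P n).2 _ k h⟩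
  smooth := by
    refine dSmooth_sub_iff.2 (dSmooth_map_iff.2 ?_)
    refine DSmooth.comp (f := fun z : Loop (simplexSpace P n) × AffSimplex (n + 1) =>
      ((z.1.1.1 z.2.ratio : PtSimplices P n), (z.2.map (Fin.last n).predAbove).squeeze))
      eval_dSmooth (dSmooth_prodMk ?_ ?_)
    · exact Loop.eval_dSmooth.comp (dSmooth_prodMk dSmooth_fst
        (AffSimplex.ratio_dSmooth.comp dSmooth_snd))
    · exact AffSimplex.squeeze_dSmooth.comp ((AffSimplex.map_dSmooth _).comp dSmooth_snd)
  map_pt := rfl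

theorem ofLoop_apply (γ : Loop (simplexSpace P n)) (v : AffSimplex (n + 1)) :
    ((ofLoop P n).toFun γ : PtSimplices P (n + 1)).1.1 v =
      (γ.1.1 v.ratio : PtSimplices P n).1.1 (v.map (Fin.last n).predAbove).squeeze := rfl

/-- Precomposition with a smooth map preserving the faces of the affine simplex is homotopic to the
identity. -/
theorem precomp_homotopic {w : AffSimplex n → AffSimplex n} (hw : DSmooth w)
    (h : ∀ v j, v.1 j = 0 → (w v).1 j = 0) {f : (simplexSpace P n).Hom (simplexSpace P n)}
    (hf : ∀ (σ : PtSimplices P n) (v : AffSimplex n), (f.toFun σ : PtSimplices P n).1.1 v =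
      σ.1.1 (w v)) : f.Homotopic (.id _) := by
  -- The line through `v` and `w v` stays in each hyperplane `v j = 0` that contains `v`. Time `0`
  -- gives `w`, time `1` the identity.
  refine ⟨fun (σ : PtSimplices P n) s => (⟨⟨fun v => σ.1.1 (.mix s v (w v)),
    σ.1.2.comp (AffSimplex.mix_dSmooth dSmooth_const dSmooth_id' hw)⟩,
    fun v j hj => σ.2 _ j (by rw [AffSimplex.mix_apply, hj, h v j hj]; ring)⟩ : PtSimplices P n),
    dSmooth_sub_iff.2 (dSmooth_map_iff.2 ?_), fun s => rfl, fun σ => ?_, fun σ => ?_⟩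
  · refine DSmooth.comp (f := fun z : (PtSimplices P n × ℝ) × AffSimplex n =>
      (z.1.1, AffSimplex.mix z.1.2 z.2 (w z.2))) eval_dSmooth ?_
    exact dSmooth_prodMk (dSmooth_fst.comp dSmooth_fst) (AffSimplex.mix_dSmooth
      (dSmooth_snd.comp dSmooth_fst) dSmooth_snd (hw.comp dSmooth_snd))
  · refine Subtype.ext (Subtype.ext (funext fun v => ?_))
    refine Eq.trans ?_ (hf σ v).symm
    simp only [AffSimplex.mix_zero]
  · refine Subtype.ext (Subtype.ext (funext fun v => ?_))
    simp only [AffSimplex.mix_one]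
    rfl

/-- Squeezing, as a map of the space of pointed simplices. -/
noncomputable def squeezeHom (P : PtSpace.{u}) (n : ℕ) :
    (simplexSpace P n).Hom (simplexSpace P n) where
  toFun (σ : PtSimplices P n) : PtSimplices P n := ⟨⟨fun v => σ.1.1 v.squeeze,
    σ.1.2.comp AffSimplex.squeeze_dSmooth⟩, fun _ j h => σ.2 _ j (AffSimplex.squeeze_of_eq_zero h)⟩
  smooth := dSmooth_sub_iff.2 (dSmooth_map_iff.2 (eval_dSmooth.comp (dSmooth_prodMk dSmooth_fst
    (AffSimplex.squeeze_dSmooth.comp dSmooth_snd))))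
  map_pt := rfl

/-- Merging undoes splitting, so this composite recovers the parameter `s` wherever it matters. Only
the squeezing of each simplex remains, and the equality is strict. -/
theorem toLoop_comp_ofLoop :
    (toLoop P n).comp (ofLoop P n) = loopSpaceMap (squeezeHom P n) := by
  ext γ
  refine Subtype.ext (Subtype.ext (funext fun s => Subtype.ext (Subtype.ext (funext fun v => ?_))))
  refine (ofLoop_apply γ (.split (Fin.last n) s v)).trans ?_
  rw [AffSimplex.ratio, AffSimplex.map_predAbove_split, AffSimplex.split_castSucc]
  change _ = ((γ : Loop (simplexSpace P n)).1.1 s : PtSimplices P n).1.1 v.squeeze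
  -- On the collar both sides are the base point, whatever the loop parameters. Outside it the
  -- parameter is `s * v n * (v n)⁻¹ = s`.
  rcases le_or_gt (v.1 (Fin.last n)) (AffSimplex.collar n) with h | h
  · have h0 := AffSimplex.squeeze_of_le h
    exact (((γ : Loop (simplexSpace P n)).1.1 _ : PtSimplices P n).2 _ _ h0).trans
      (((γ : Loop (simplexSpace P n)).1.1 s : PtSimplices P n).2 _ _ h0).symm
  · rw [AffSimplex.recip_of_ge h.le, mul_assoc,
      mul_inv_cancel₀ ((AffSimplex.collar_pos n).trans h).ne', mul_one]

/-- One composite is precomposition with a face-preserving self-map of `𝔸ⁿ⁺¹`, the other is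
squeezing applied along loops. `precomp_homotopic` contracts both to the identity. -/
theorem toLoop_isEquiv (P : PtSpace.{u}) (n : ℕ) : (toLoop P n).IsEquiv := by
  refine ⟨ofLoop P n, ?_, ?_⟩
  · refine precomp_homotopic (w := fun v =>
      .split (Fin.last n) v.ratio (v.map (Fin.last n).predAbove).squeeze)
      (AffSimplex.split_dSmooth _ AffSimplex.ratio_dSmooth
        (AffSimplex.squeeze_dSmooth.comp (AffSimplex.map_dSmooth _))) ?_ fun _ _ => rfl
    intro v j h
    rcases AffSimplex.face_cases h with ⟨rfl, h'⟩ | ⟨rfl, h'⟩ | ⟨k, h', rfl⟩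
    · rw [AffSimplex.split_castSucc, h', zero_mul]
    · rw [AffSimplex.split_succ, h', sub_self, zero_mul]
    · by_cases hk : k = Fin.last n
      · subst hk
        rw [Fin.succAbove_castSucc_self, AffSimplex.split_succ, h', mul_zero]
      · rw [AffSimplex.split_of_ne hk, h']
  · rw [toLoop_comp_ofLoop]
    exact (precomp_homotopic AffSimplex.squeeze_dSmooth
      (fun v j => AffSimplex.squeeze_of_eq_zero) fun _ _ => rfl).loopSpaceMap

/-! ### Iterated loop spaces -/

/-- The comparison of pointed simplices with points of the iterated loop space. -/
noncomputable def toIterLoop (P : PtSpace.{u}) : (n : ℕ) → (simplexSpace P n).Hom (iterLoop P n)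
  | 0 => ⟨fun σ : PtSimplices P 0 => σ.1.1 ⟨WithLp.toLp 2 fun _ => 1, by simp⟩,
      eval_dSmooth.comp (dSmooth_prodMk dSmooth_id' dSmooth_const), rfl⟩
  | n + 1 => (loopSpaceMap (toIterLoop P n)).comp (toLoop P n)

theorem toIterLoop_isEquiv (P : PtSpace.{u}) (n : ℕ) : (toIterLoop P n).IsEquiv := by
  induction n with
  | zero =>
    -- `𝔸⁰` is one point, with coordinate `1`, so the boundary condition is vacuous and evaluation
    -- is inverse to taking constant maps.
    refine ⟨⟨fun a => (⟨⟨fun _ => a, dSmooth_const⟩, fun v j h => ?_⟩ : PtSimplices P 0),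
      dSmooth_sub_iff.2 (dSmooth_map_iff.2 dSmooth_fst), rfl⟩, .of_eq fun σ => ?_,
      .of_eq fun a => rfl⟩
    · exact absurd (h.symm.trans (v.coord_eq_one j)) zero_ne_one
    · refine Subtype.ext (Subtype.ext (funext fun v => ?_))
      refine congrArg (σ : PtSimplices P 0).1.1 ?_
      ext j
      exact (v.coord_eq_one j).symm
  | succ n ih => exact ih.loopSpaceMap.comp (toLoop_isEquiv P n)

theorem toIterLoop_natural (f : P.Hom Q) (n : ℕ) (σ : (simplexSpace P n).carrier) :
    (toIterLoop Q n).toFun ((simplexSpaceMap f n).toFun σ) =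
      (iterLoopMap f n).toFun ((toIterLoop P n).toFun σ) := by
  induction n with
  | zero => rfl
  | succ n ih =>
    refine Subtype.ext (Subtype.ext (funext fun s => ?_))
    exact ih (((toLoop P n).toFun σ : Loop (simplexSpace P n)).1.1 s)

end Diffeo

namespace Diffeo

open Diffeology CategoryTheory Opposite MonoidalCategory CartesianMonoidalCategory SSet
open SimplicialHomotopy
open scoped Simplicial ContDiff

/-! ### Pointed simplices of the smooth singular simplicial set -/

section Comparison

variable {X : Type u} [DiffeologicalSpace X] {x : X} {n : ℕ}

/-- The smooth map corresponding to a map from a standard simplex. -/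
noncomputable def toSmooth (φ : Δ[n] ⟶ smoothSing X) : SmoothMap (AffSimplex n) X := SSet.yonedaEquiv φ

theorem toSmooth_injective : Function.Injective (toSmooth (X := X) (n := n)) :=
  SSet.yonedaEquiv.injective

theorem toSmooth_surjective : Function.Surjective (toSmooth (X := X) (n := n)) :=
  SSet.yonedaEquiv.surjective

theorem toSmooth_const (v : AffSimplex n) :
    (toSmooth (SSet.const (vertex x) : Δ[n] ⟶ smoothSing X)).1 v = x := rfl

theorem toSmooth_δ (φ : Δ[n + 1] ⟶ smoothSing X) (j : Fin (n + 2)) (v : AffSimplex n) :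
    (toSmooth (stdSimplex.δ j ≫ φ)).1 v = (toSmooth φ).1 (v.map j.succAbove) := by
  rw [toSmooth, stdSimplex.yonedaEquiv_δ_comp]
  rfl

theorem toSmooth_eq_of_δ_eq {φ : Δ[n + 1] ⟶ smoothSing X} {ψ : Δ[n] ⟶ smoothSing X}
    {j : Fin (n + 2)} (h : stdSimplex.δ j ≫ φ = ψ) (v : AffSimplex n) :
    (toSmooth φ).1 (v.map j.succAbove) = (toSmooth ψ).1 v := by
  rw [← h, toSmooth_δ]

/-- The simplex of the space of pointed simplices given by a pointed simplex of the smooth singular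
simplicial set. -/
noncomputable def toPtSimplices (f : (smoothSing X).PtSimplex n (vertex x)) : PtSimplices ⟨X, x⟩ n :=
  ⟨toSmooth f.map, fun v j h => by
    obtain _ | n := n
    · exact absurd (h.symm.trans (v.coord_eq_one j)) zero_ne_one
    · obtain ⟨w, rfl, -⟩ := AffSimplex.exists_map_succAbove h
      exact toSmooth_eq_of_δ_eq (f.δ_map j) w⟩

theorem toPtSimplices_surjective :
    Function.Surjective (toPtSimplices (X := X) (x := x) (n := n)) := fun σ => by
  obtain ⟨φ, hφ⟩ := toSmooth_surjective σ.1
  refine ⟨⟨φ, ?_⟩, Subtype.ext hφ⟩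
  obtain _ | n := n
  -- The boundary of `Δ[0]` is empty.
  · ext
  · refine boundary.hom_ext fun j => ?_
    rw [← Category.assoc, boundary.ι_ι]
    refine Eq.trans (b := SSet.const (vertex x)) (toSmooth_injective ?_) (by simp)
    refine Subtype.ext (funext fun v => ?_)
    rw [toSmooth_δ, toSmooth_const, hφ]
    exact σ.2 _ j (AffSimplex.map_apply_of_notMem _ fun i => j.succAbove_ne i)

/-- A smooth path of pointed simplices is a simplicial homotopy. -/
noncomputable def homotopyOfPath {f g : (smoothSing X).PtSimplex n (vertex x)}
    {γ : ℝ → PtSimplices ⟨X, x⟩ n} (hγ : DSmooth γ) (h0 : γ 0 = toPtSimplices f)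
    (h1 : γ 1 = toPtSimplices g) : f.Homotopy g where
  h :=
    -- The simplex of `Δ[1]` induces an affine map to `𝔸¹`, whose coordinate at the vertex `1` is
    -- the time. It takes all real values, hence the use of paths on the whole line.
    { app U := TypeCat.ofHom fun s =>
        ⟨fun v => (γ ((v.map (stdSimplex.asOrderHom s.2)).1 1)).1.1
          (v.map (stdSimplex.asOrderHom s.1)),
        eval_dSmooth.comp (dSmooth_prodMk (hγ.comp ((AffSimplex.coord_dSmooth 1).comp
          (AffSimplex.map_dSmooth _))) (AffSimplex.map_dSmooth _))⟩
      naturality U V θ := by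
        ext s
        refine Subtype.ext (funext fun v => ?_)
        change (γ ((v.map (stdSimplex.asOrderHom s.2 ∘ θ.unop.toOrderHom)).1 1)).1.1
          (v.map (stdSimplex.asOrderHom s.1 ∘ θ.unop.toOrderHom)) = _
        rw [AffSimplex.map_comp, AffSimplex.map_comp]
        rfl }
  h₀ := by
    apply toSmooth_injective
    refine Subtype.ext (funext fun v => ?_)
    change (γ ((v.map fun _ => (0 : Fin 2)).1 1)).1.1 (v.map id) = (toPtSimplices f).1.1 v
    rw [AffSimplex.map_id, AffSimplex.map_apply_of_notMem v fun _ => Fin.zero_ne_one, h0]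
  h₁ := by
    apply toSmooth_injective
    refine Subtype.ext (funext fun v => ?_)
    change (γ ((v.map fun _ => (1 : Fin 2)).1 1)).1.1 (v.map id) = (toPtSimplices g).1.1 v
    have h : (v.map fun _ => (1 : Fin 2)).1 1 = 1 := by
      rw [AffSimplex.map_apply]
      simpa using v.2
    rw [AffSimplex.map_id, h, h1]
  rel := by
    ext ⟨⟨m⟩⟩ ⟨⟨s, hs⟩, b⟩
    -- A boundary simplex misses a vertex `j`, so its affine map lands in the hyperplane where every
    -- `γ t` is constant.
    obtain ⟨j, hj⟩ := (mem_boundary_iff_notMem_range s).1 hs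
    refine Subtype.ext (funext fun v => ?_)
    exact (γ _).2 _ j (AffSimplex.map_apply_of_notMem v fun i hi => hj ⟨i, hi⟩)

/-- The path at time `s` is the slice of the relating simplex along `split i s`. It interpolates
between the faces `i` and `i + 1`, which are `f` and `g`. -/
theorem pathRel_of_relStruct {f g : (smoothSing X).PtSimplex n (vertex x)} {i : Fin (n + 1)}
    (r : PtSimplex.RelStruct f g i) : PathRel (toPtSimplices f) (toPtSimplices g) := by
  have key : ∀ (s : ℝ) (v : AffSimplex n) (j : Fin (n + 1)), v.1 j = 0 →
      (toSmooth r.map).1 (.split i s v) = x := by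
    intro s v j hj
    -- If the split coordinate itself vanishes, so do both shares: the point lies on the face given
    -- by `f`, and there on the boundary of `f`. Otherwise it lies on one of the constant faces.
    by_cases h : j = i
    · subst h
      obtain ⟨w, hw, hw'⟩ := AffSimplex.exists_map_succAbove (j := j.castSucc)
        (v := .split j s v) (by rw [AffSimplex.split_castSucc, hj, mul_zero])
      rw [← hw, toSmooth_eq_of_δ_eq r.δ_castSucc_map]
      refine (toPtSimplices f).2 w j ?_
      rw [hw', Fin.succAbove_castSucc_self, AffSimplex.split_succ, hj, mul_zero]
    · obtain ⟨w, hw, -⟩ := AffSimplex.exists_map_succAbove (j := i.castSucc.succAbove j)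
        (v := .split i s v) (by rw [AffSimplex.split_of_ne h, hj])
      rw [← hw, toSmooth_eq_of_δ_eq (ψ := SSet.const (vertex x)), toSmooth_const]
      rcases lt_or_gt_of_ne h with h | h
      · rw [Fin.succAbove_of_castSucc_lt _ _ (Fin.castSucc_lt_castSucc_iff.2 h)]
        exact r.δ_map_of_lt _ (Fin.castSucc_lt_castSucc_iff.2 h)
      · rw [Fin.succAbove_of_le_castSucc _ _ (Fin.castSucc_le_castSucc_iff.2 h.le)]
        exact r.δ_map_of_gt _ (Fin.succ_lt_succ_iff.2 h)
  refine ⟨fun s => ⟨⟨fun v => (toSmooth r.map).1 (.split i s v), (toSmooth r.map).2.comp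
    (AffSimplex.split_dSmooth i dSmooth_const dSmooth_id')⟩, key s⟩,
    dSmooth_sub_iff.2 (dSmooth_map_iff.2 ((toSmooth r.map).2.comp
      (AffSimplex.split_dSmooth i dSmooth_fst dSmooth_snd))), ?_, ?_⟩
  · refine Subtype.ext (Subtype.ext (funext fun v => ?_))
    exact (congrArg (toSmooth r.map).1 (AffSimplex.split_zero i v)).trans
      (toSmooth_eq_of_δ_eq r.δ_castSucc_map v)
  · refine Subtype.ext (Subtype.ext (funext fun v => ?_))
    exact (congrArg (toSmooth r.map).1 (AffSimplex.split_one i v)).trans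
      (toSmooth_eq_of_δ_eq r.δ_succ_map v)

theorem pathRel_of_homotopy {f g : (smoothSing X).PtSimplex n (vertex x)} (H : f.Homotopy g) :
    PathRel (toPtSimplices f) (toPtSimplices g) := by
  have key : ∀ k : Fin (n + 2), PathRel (toPtSimplices (stage H 0)) (toPtSimplices (stage H k)) := by
    intro k
    induction k using Fin.induction with
    | zero => exact (pathSetoid _).refl _
    | succ k ih => exact (pathSetoid _).trans ih (pathRel_of_relStruct (stageRel H k))
  have h := key (Fin.last _)
  rw [stage_zero, stage_last] at h
  -- The stages run backwards: stage `0` is `g` and the last one is `f`.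
  exact (pathSetoid _).symm h

variable (X x n) in
/-- The comparison of simplicial homotopy classes with the path components of the space of pointed
simplices. -/
noncomputable def piSToPi0 : PiS (smoothSing X) (vertex x) n → Pi0 (PtSimplices ⟨X, x⟩ n) :=
  Quot.lift (fun f => Pi0.mk (toPtSimplices f)) fun _ _ ⟨H⟩ =>
    Quotient.sound (pathRel_of_homotopy H)

theorem piSToPi0_bijective : Function.Bijective (piSToPi0 X x n) := by
  constructor
  · intro a b h
    obtain ⟨f, rfl⟩ := a.mk_surjective
    obtain ⟨g, rfl⟩ := b.mk_surjective
    obtain ⟨γ, hγ, h0, h1⟩ := Quotient.exact h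
    exact (homotopyOfPath hγ h0 h1).eq
  · intro a
    induction a using Quotient.inductionOn with
    | h σ =>
      obtain ⟨f, rfl⟩ := toPtSimplices_surjective σ
      exact ⟨PiS.mk f, rfl⟩

variable (X x n) in
/-- The comparison of simplicial and smooth homotopy groups. -/
noncomputable def piSToPiD (a : PiS (smoothSing X) (vertex x) n) : PiD n X x :=
  (toIterLoop ⟨X, x⟩ n).pi0 (piSToPi0 X x n a)

theorem piSToPiD_bijective : Function.Bijective (piSToPiD X x n) :=
  (toIterLoop_isEquiv ⟨X, x⟩ n).pi0_bijective.comp piSToPi0_bijective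

theorem piSToPiD_base : piSToPiD X x n (PiS.base _ _ _) = PiD.base n X x :=
  congrArg Pi0.mk (toIterLoop ⟨X, x⟩ n).map_pt

theorem piSToPiD_map {Y : Type u} [DiffeologicalSpace Y] {y : Y} (f : X → Y) (hf : DSmooth f)
    (hxy : f x = y) (a : PiS (smoothSing X) (vertex x) n) :
    piSToPiD Y y n (PiS.map (smoothSingMap f hf) (smoothSingMap_vertex hf hxy) n a) =
      PiD.map n f hf hxy (piSToPiD X x n a) := by
  obtain ⟨σ, rfl⟩ := a.mk_surjective
  exact congrArg Pi0.mk (toIterLoop_natural (P := ⟨X, x⟩) (Q := ⟨Y, y⟩) ⟨f, hf, hxy⟩ n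
    (toPtSimplices σ))

end Comparison

end Diffeo

namespace Diffeo

open Diffeology CategoryTheory Opposite MonoidalCategory CartesianMonoidalCategory SSet
open SimplicialHomotopy
open scoped Simplicial ContDiff

/-! ### Compatibility with the products -/

namespace AffSimplex

variable {Z : Type u} [DiffeologicalSpace Z] {n : ℕ}

/-- The map on vertices which moves the last one by `r`. -/
def moveLast (n : ℕ) (r : Fin 3) (i : Fin (n + 1)) : Fin (n + 3) :=
  ⟨i + if (i : ℕ) = n then (r : ℕ) else 0, by split_ifs <;> lia⟩

/-- The point of `𝔸ⁿ⁺²` obtained from a point of `𝔸ⁿ` by dividing the last coordinate among the last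
three vertices. -/
noncomputable def triple (c : ℝ × ℝ) (v : AffSimplex n) : AffSimplex (n + 2) :=
  ⟨WithLp.toLp 2 fun j => c.1 * (map (moveLast n 0) v).1 j + c.2 * (map (moveLast n 1) v).1 j +
    (1 - c.1 - c.2) * (map (moveLast n 2) v).1 j, by
    simp [Finset.sum_add_distrib, ← Finset.mul_sum, (map _ _).2]⟩

theorem triple_apply (c : ℝ × ℝ) (v : AffSimplex n) (j : Fin (n + 3)) :
    (triple c v).1 j = c.1 * (map (moveLast n 0) v).1 j + c.2 * (map (moveLast n 1) v).1 j +
      (1 - c.1 - c.2) * (map (moveLast n 2) v).1 j := rfl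

theorem triple_dSmooth {c : Z → ℝ × ℝ} {v : Z → AffSimplex n} (hc : DSmooth c)
    (hv : DSmooth v) : DSmooth fun z => triple (c z) (v z) := by
  have h (r : Fin 3) (j : Fin (n + 3)) : DSmooth fun z => (map (moveLast n r) (v z)).1 j :=
    (coord_dSmooth j).comp ((map_dSmooth _).comp hv)
  have h1 : DSmooth fun z => (c z).1 := dSmooth_fst.comp hc
  have h2 : DSmooth fun z => (c z).2 := dSmooth_snd.comp hc
  exact dSmooth_iff.2 fun j => dSmooth_add (dSmooth_add (dSmooth_mul h1 (h 0 j))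
    (dSmooth_mul h2 (h 1 j))) (dSmooth_mul (dSmooth_sub (dSmooth_sub dSmooth_const h1) h2) (h 2 j))

theorem triple_eq_zero (c : ℝ × ℝ) {v : AffSimplex n} {j : Fin (n + 3)}
    (h : ∀ r i, moveLast n r i = j → v.1 i = 0) : (triple c v).1 j = 0 := by
  have h' (r : Fin 3) : (map (moveLast n r) v).1 j = 0 := by
    rw [map_apply]
    exact Finset.sum_eq_zero fun i hi => h r i (Finset.mem_filter.1 hi).2
  rw [triple_apply, h', h', h']
  ring

/-- Affine maps commute with mixtures, so a face inclusion after a splitting is determined by where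
it puts the two copies of the last vertex. This identifies the three sides of the triangle of
weights with faces of `𝔸ⁿ⁺²`. -/
theorem map_split_last (θ : Fin (n + 2) → Fin (n + 3)) (s : ℝ) (v : AffSimplex n) {q r : Fin 3}
    (hq : ∀ i, θ ((Fin.last n).succ.succAbove i) = moveLast n q i)
    (hr : ∀ i, θ ((Fin.last n).castSucc.succAbove i) = moveLast n r i) :
    map θ (split (Fin.last n) s v) = mix s (map (moveLast n q) v) (map (moveLast n r) v) := by
  rw [split, map_mix, ← map_comp, ← map_comp, ← funext hq, ← funext hr]
  rfl

theorem triple_fst_face (s : ℝ) (v : AffSimplex n) : triple (0, s) v =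
    map (Fin.last n).castSucc.castSucc.succAbove (split (Fin.last n) s v) := by
  rw [map_split_last (q := 1) (r := 2)]
  · ext j
    rw [triple_apply, mix_apply]
    ring
  all_goals
    intro i
    simp only [moveLast, Fin.succAbove, Fin.ext_iff, Fin.lt_def]
    grind

theorem triple_mid_face (s : ℝ) (v : AffSimplex n) : triple (s, 0) v =
    map (Fin.last n).castSucc.succ.succAbove (split (Fin.last n) s v) := by
  rw [map_split_last (q := 0) (r := 2)]
  · ext j
    rw [triple_apply, mix_apply]
    ring
  all_goals
    intro i
    simp only [moveLast, Fin.succAbove, Fin.ext_iff, Fin.lt_def]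
    grind

theorem triple_last_face (s : ℝ) (v : AffSimplex n) : triple (s, 1 - s) v =
    map (Fin.last n).succ.succ.succAbove (split (Fin.last n) s v) := by
  rw [map_split_last (q := 0) (r := 1)]
  · ext j
    rw [triple_apply, mix_apply]
    ring
  all_goals
    intro i
    simp only [moveLast, Fin.succAbove, Fin.ext_iff, Fin.lt_def]
    grind

end AffSimplex

/-- Concatenation chooses pointwise between two reparametrized loops, so it commutes strictly with
applying `f`. -/
theorem loopSpaceMap_mul {P : PtSpace.{u}} {Q : PtSpace.{v}} (f : P.Hom Q) (γ δ : Loop P) :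
    (loopSpaceMap f).toFun (γ.mul δ) =
      Loop.mul ((loopSpaceMap f).toFun γ) ((loopSpaceMap f).toFun δ) :=
  Subtype.ext (Subtype.ext (funext fun _ => apply_ite f.toFun _ _ _))

section

variable {X : Type u} [DiffeologicalSpace X] {x : X} {n : ℕ}

/-- Distributing the last coordinate of `𝔸ⁿ` over three vertices turns the witnessing simplex into a
family `c` of pointed simplices over `ℝ × ℝ`. The loops of `f`, `g`, `h` are its restrictions to the
segments from `(0, 0)` to `(0, 1)`, from `(0, 1)` to `(1, 0)`, and from `(0, 0)` to `(1, 0)`. -/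
theorem toLoop_mul_eq {f g h : (smoothSing X).PtSimplex (n + 1) (vertex x)}
    (H : M (Fin.last n) g f h) :
    Pi0.mk (Loop.mul ((toLoop ⟨X, x⟩ n).toFun (toPtSimplices f))
      ((toLoop ⟨X, x⟩ n).toFun (toPtSimplices g))) =
        Pi0.mk ((toLoop ⟨X, x⟩ n).toFun (toPtSimplices h) : Loop (simplexSpace ⟨X, x⟩ n)) := by
  obtain ⟨m⟩ := H
  have key : ∀ (c : ℝ × ℝ) (v : AffSimplex n) (j : Fin (n + 1)), v.1 j = 0 →
      (toSmooth m.map).1 (.triple c v) = x := by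
    intro c v j hj
    by_cases h : j = Fin.last n
    -- If the divided coordinate is zero, all three shares vanish. One places the point on the face
    -- given by `f`, and another then places it on the boundary of `f`.
    · have h0 (k : Fin (n + 3)) (hk : n ≤ (k : ℕ)) : (AffSimplex.triple c v).1 k = 0 :=
        AffSimplex.triple_eq_zero c fun r i hi => by
          obtain rfl : i = j := by
            subst h hi
            simp only [AffSimplex.moveLast] at hk
            grind
          exact hj
      obtain ⟨w, hw, hw'⟩ := AffSimplex.exists_map_succAbove
        (h0 (Fin.last n).castSucc.castSucc (by simp))
      rw [← hw, toSmooth_eq_of_δ_eq m.δ_castSucc_castSucc_map]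
      refine (toPtSimplices f).2 w (Fin.last (n + 1)) ?_
      rw [hw']
      refine h0 _ ?_
      rw [Fin.succAbove_of_le_castSucc _ _ (by simp [Fin.le_def])]
      simp only [Fin.val_succ, Fin.val_last]
      lia
    · have hj' : (j : ℕ) < n := Fin.val_lt_last h
      obtain ⟨w, hw, -⟩ := AffSimplex.exists_map_succAbove (j := j.castSucc.castSucc)
        (v := .triple c v) (AffSimplex.triple_eq_zero c fun r i hi => by
          obtain rfl : i = j := by
            simp only [AffSimplex.moveLast, Fin.ext_iff, Fin.val_castSucc] at hi ⊢
            grind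
          exact hj)
      rw [← hw, toSmooth_eq_of_δ_eq (m.δ_map_of_lt _ (by simpa [Fin.lt_def] using hj')),
        toSmooth_const]
  let c : ℝ × ℝ → PtSimplices ⟨X, x⟩ n := fun z => ⟨⟨fun v => (toSmooth m.map).1 (.triple z v),
    (toSmooth m.map).2.comp (AffSimplex.triple_dSmooth dSmooth_const dSmooth_id')⟩, key z⟩
  have hc : DSmooth c := dSmooth_sub_iff.2 (dSmooth_map_iff.2 ((toSmooth m.map).2.comp
    (AffSimplex.triple_dSmooth dSmooth_fst dSmooth_snd)))
  let F := ((toLoop ⟨X, x⟩ n).toFun (toPtSimplices f) : Loop (simplexSpace ⟨X, x⟩ n))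
  let G := ((toLoop ⟨X, x⟩ n).toFun (toPtSimplices g) : Loop (simplexSpace ⟨X, x⟩ n))
  let K := ((toLoop ⟨X, x⟩ n).toFun (toPtSimplices h) : Loop (simplexSpace ⟨X, x⟩ n))
  have hF (s : ℝ) : c (0, s) = F.1.1 s := Subtype.ext (Subtype.ext (funext fun v =>
    (congrArg (toSmooth m.map).1 (AffSimplex.triple_fst_face s v)).trans
      (toSmooth_eq_of_δ_eq m.δ_castSucc_castSucc_map _)))
  have hK (s : ℝ) : c (s, 0) = K.1.1 s := Subtype.ext (Subtype.ext (funext fun v =>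
    (congrArg (toSmooth m.map).1 (AffSimplex.triple_mid_face s v)).trans
      (toSmooth_eq_of_δ_eq m.δ_succ_castSucc_map _)))
  have hG (s : ℝ) : c (s, 1 - s) = G.1.1 s := Subtype.ext (Subtype.ext (funext fun v =>
    (congrArg (toSmooth m.map).1 (AffSimplex.triple_last_face s v)).trans
      (toSmooth_eq_of_δ_eq m.δ_succ_succ_map _)))
  let α : ℝ → ℝ × ℝ := concat (fun s => (0, s)) (fun s => (s, 1 - s))
  have hα : DSmooth α := concat_dSmooth (dSmooth_prodMk dSmooth_const dSmooth_id')
    (dSmooth_prodMk dSmooth_id' (dSmooth_sub dSmooth_const dSmooth_id')) (by simp)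
  have hα0 : α 0 = (0, 0) := concat_zero _ _
  have hα1 : α 1 = (1, 0) := (concat_one _ _).trans (by simp)
  -- The straight-line homotopy in the plane from `α t` to `(t, 0)`. Both paths join `(0, 0)` to
  -- `(1, 0)`, so the end points stay fixed.
  refine Loop.mk_eq_iff.2 ⟨fun z => c ((1 - z.1) * (α z.2).1 + z.1 * z.2, (1 - z.1) * (α z.2).2),
    hc.comp ?_, fun s => ?_, fun s => ?_, fun t => ?_, fun t => ?_⟩
  · have h1 : DSmooth fun z : ℝ × ℝ => 1 - z.1 := dSmooth_sub dSmooth_const dSmooth_fst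
    have h2 : DSmooth fun z : ℝ × ℝ => α z.2 := hα.comp dSmooth_snd
    exact dSmooth_prodMk (dSmooth_add (dSmooth_mul h1 (dSmooth_fst.comp h2))
      (dSmooth_mul dSmooth_fst dSmooth_snd)) (dSmooth_mul h1 (dSmooth_snd.comp h2))
  · simp only [hα0, mul_zero, add_zero]
    exact (hK 0).trans K.2.1
  · simp only [hα1, mul_zero, mul_one, sub_add_cancel]
    exact (hK 1).trans K.2.2
  · simp only [sub_zero, one_mul, zero_mul, add_zero]
    change c (α t) = concat F.1.1 G.1.1 t
    simp only [α, concat]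
    split_ifs
    · exact hF _
    · exact hG _
  · simp only [sub_self, zero_mul, one_mul, zero_add]
    exact hK t

/-- The outermost loop coordinate of the iterated loop space comes from the last splitting, the one
handled by `toLoop_mul_eq`; the remaining comparison is applied pointwise along loops. -/
theorem piSToPiD_mul [(smoothSing X).KanComplex] (a b : PiS (smoothSing X) (vertex x) (n + 1)) :
    piSToPiD X x (n + 1) (a * b) = piSToPiD X x (n + 1) a * piSToPiD X x (n + 1) b := by
  obtain ⟨f, rfl⟩ := a.mk_surjective
  obtain ⟨g, rfl⟩ := b.mk_surjective
  have H := mulRep_spec f g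
  rw [PiS.mk_mul_mk H]
  refine (congrArg (loopSpaceMap (toIterLoop ⟨X, x⟩ n)).pi0 (toLoop_mul_eq H)).symm.trans ?_
  exact congrArg Pi0.mk (loopSpaceMap_mul (toIterLoop ⟨X, x⟩ n) _ _)

end

end Diffeo

/-! ### The comparison theorem -/

theorem theorem4p6 :
    ∃ e : ∀ (n : ℕ) (X : Type u) [DiffeologicalSpace X] (x : X)
        [SSet.KanComplex (Diffeo.smoothSing X)],
        Diffeo.PiD n X x ≃ SimplicialHomotopy.PiS (Diffeo.smoothSing X) (Diffeo.vertex x) n,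
      -- the bijections are pointed,
      (∀ (n : ℕ) (X : Type u) [DiffeologicalSpace X] (x : X)
        [SSet.KanComplex (Diffeo.smoothSing X)],
        e n X x (Diffeo.PiD.base n X x) =
          SimplicialHomotopy.PiS.base (Diffeo.smoothSing X) (Diffeo.vertex x) n) ∧
      -- they are group isomorphisms in positive degrees,
      (∀ (n : ℕ) (X : Type u) [DiffeologicalSpace X] (x : X)
        [SSet.KanComplex (Diffeo.smoothSing X)] (a b : Diffeo.PiD (n + 1) X x),
        e (n + 1) X x (a * b) = e (n + 1) X x a * e (n + 1) X x b) ∧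
      -- and they are natural with respect to pointed smooth maps.
      (∀ (n : ℕ) (X Y : Type u) [DiffeologicalSpace X] [DiffeologicalSpace Y] (x : X) (y : Y)
        [SSet.KanComplex (Diffeo.smoothSing X)] [SSet.KanComplex (Diffeo.smoothSing Y)]
        (f : X → Y) (hf : Diffeology.DSmooth f) (hxy : f x = y) (a : Diffeo.PiD n X x),
        e n Y y (Diffeo.PiD.map n f hf hxy a) =
          SimplicialHomotopy.PiS.map (Diffeo.smoothSingMap f hf)
            (Diffeo.smoothSingMap_vertex hf hxy) n (e n X x a)) := by
  -- The explicit map goes from simplices to loops, so the bijection is its inverse, and each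
  -- property is transferred from that map.
  refine ⟨fun n X _ x _ => (Equiv.ofBijective _ (Diffeo.piSToPiD_bijective (n := n))).symm,
    fun n X _ x _ => ?_, fun n X _ x _ a b => ?_, fun n X Y _ _ x y _ _ f hf hxy a => ?_⟩
  · rw [Equiv.symm_apply_eq]
    exact Diffeo.piSToPiD_base.symm
  · rw [Equiv.symm_apply_eq]
    refine Eq.trans ?_ (Diffeo.piSToPiD_mul _ _).symm
    exact congrArg₂ _ (Equiv.ofBijective_apply_symm_apply _ _ a).symm
      (Equiv.ofBijective_apply_symm_apply _ _ b).symm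
  · rw [Equiv.symm_apply_eq]
    refine Eq.trans ?_ (Diffeo.piSToPiD_map f hf hxy _).symm
    exact congrArg _ (Equiv.ofBijective_apply_symm_apply _ _ a).symm
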